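/- For $r>0$, $a\ge 0$ with $ra<1/2$ let $W_{a,r}:[0,1]\to[0,1]$ be the continuous piecewise linear map $$W_{a,r}(x)=\begin{cases}1-\frac{2(2+a)}{1+a-2ra}\,x, & 0\le x<\frac12-\frac{1/2+ra}{2+a},\\ (2+a)(x-\tfrac12)+\tfrac12+ra, & \frac12-\frac{1/2+ra}{2+a}\le x<\frac12,\\ -(2+a)(x-\tfrac12)+\tfrac12+ra, & \frac12\le x<\frac12+\frac{1/2+ra}{2+a},\\ 1+\frac{2(2+a)}{1+a-2ra}(x-1), & \frac12+\frac{1/2+ra}{2+a}\le x\le 1,\end{cases}$$ and let $W_0=W_{0,r}$ (which does not depend on $r$). (These are the $W$-shaped maps with parameters $s_1=s_2=2$, $p=q=1$.) An acim is an invariant probability measure that is absolutely continuous with respect to Lebesgue measure on $[0,1]$. (1) For all $r>0$, $a\ge0$ with $ra<1/2$, $W_{a,r}$ maps $[0,1]$ onto $[0,1]$ and has exactly one acim $\mu_{a,r}$; write $\mu_0$ for the acim of $W_0$. If $a>0$, then $|W_{a,r}'|>2$ off the three turning points, $\mu_{a,r}$ has support $[0,1]$ and is equivalent to Lebesgue measure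 on $[0,1]$, and $W_{a,r}$ is exact with respect to $\mu_{a,r}$. (2) For every $r>0$, as $a\to0^+$, $\mu_{a,r}$ converges weakly to $\mu_{0,r}:=\frac{1}{1+2r}\mu_0+\frac{2r}{1+2r}\delta_{1/2}$. (3) Let $d$ be any metric inducing the topology of weak convergence of probability measures on $\mathbb R$, and let $r_n=n$ for $n\ge1$. For each $n\ge 1$, all sufficiently small $a_n>0$ satisfy $$r_na_n<\tfrac12\quad\text{and}\quad d(\mu_{a_n,r_n},\mu_{0,r_n})<\tfrac1n .$$ Let $(a_n)_{n\ge1}$ be any sequence of positive numbers satisfying these two conditions for every $n\ge 1$, and put $\tau_n=W_{a_n,r_n}$ (so that by (1) each $\tau_n$ is exact on $[0,1]$ with $|\tau_n'|>2$). Then $\tau_n\to W_0$ uniformly on $[0,1]$, the acims $\mu_{a_n,r_n}$ of $\tau_n$ converge weakly to $\delta_{1/2}$, and the invariant densities $f_n$ of $\mu_{a_n,r_n}$ have no uniform positive lower bound on their supports: there is no $c>0$ such that, for every $n\ge1$, $f_n\ge c$ almost everywhere on $\{f_n>0\}$. -/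

import Mathlib

open MeasureTheory Set Filter Topology
open scoped ENNReal

noncomputable section

/-- The `W`-shaped map with parameters `s₁ s₂ p q r a`, given by its four affine branches.
Only its values on `[0,1]` matter; the two outer branches are extended affinely outside. -/
def wMap (s₁ s₂ p q r a : ℝ) (x : ℝ) : ℝ :=
  if x < 1 / 2 - (1 / 2 + r * a) / (s₁ + p * a) then
    1 - 2 * (s₁ + p * a) / (s₁ - 1 + p * a - 2 * r * a) * x
  else if x < 1 / 2 then
    (s₁ + p * a) * (x - 1 / 2) + 1 / 2 + r * a
  else if x < 1 / 2 + (1 / 2 + r * a) / (s₂ + q * a) then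
    -(s₂ + q * a) * (x - 1 / 2) + 1 / 2 + r * a
  else
    1 + 2 * (s₂ + q * a) / (s₂ - 1 + q * a - 2 * r * a) * (x - 1)

/-- The family `W_{a,r}`: slopes `s₁ = s₂ = 2` and `p = q = 1`. -/
def wFamily (r a : ℝ) : ℝ → ℝ := wMap 2 2 1 1 r a

/-- The unperturbed map `W_0` (`a = 0`, where `r` plays no role; see `wFamily_zero`). -/
def wZero : ℝ → ℝ := wFamily 1 0

theorem wFamily_zero (r : ℝ) : wFamily r 0 = wZero := by
  funext x
  simp [wZero, wFamily, wMap]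

/-- The three interior end points of the branches of `W_{a,r}`. -/
def wBreaks (r a : ℝ) : Set ℝ :=
  {1 / 2 - (1 / 2 + r * a) / (2 + a), 1 / 2, 1 / 2 + (1 / 2 + r * a) / (2 + a)}

/-- `μ` is an absolutely continuous (with respect to Lebesgue measure on `[0,1]`) invariant
probability measure (acim) of the map `T` of `[0,1]`. -/
def IsAcim (T : ℝ → ℝ) (μ : ProbabilityMeasure ℝ) : Prop :=
  MeasurePreserving T (μ : Measure ℝ) (μ : Measure ℝ) ∧
    (μ : Measure ℝ) ≪ volume.restrict (Icc 0 1)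

/-- Exactness of `T` with respect to `μ`: every measurable set which, for every `n`, is up to
`μ`-null sets of the form `T⁻ⁿ B` with `B` measurable, has measure `0` or `1`. -/
def IsExact (T : ℝ → ℝ) (μ : ProbabilityMeasure ℝ) : Prop :=
  ∀ A : Set ℝ, MeasurableSet A →
    (∀ n : ℕ, ∃ B : Set ℝ, MeasurableSet B ∧ A =ᵐ[(μ : Measure ℝ)] (T^[n]) ⁻¹' B) →
    (μ : Measure ℝ) A = 0 ∨ (μ : Measure ℝ) A = 1

/-- The Lebesgue density of `μ`. -/
def density (μ : ProbabilityMeasure ℝ) : ℝ → ℝ≥0∞ := (μ : Measure ℝ).rnDeriv volume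

/-- The Dirac measure at `1/2`. -/
def diracHalf : ProbabilityMeasure ℝ := ⟨Measure.dirac (1 / 2), inferInstance⟩

/-- The measure `μ₀ / (1 + 2r) + (2r / (1 + 2r)) δ_{1/2}`. -/
def limitMeasure (μ₀ : ProbabilityMeasure ℝ) (r : ℝ) (hr : 0 ≤ r) : ProbabilityMeasure ℝ :=
  ⟨ENNReal.ofReal (1 / (1 + 2 * r)) • (μ₀ : Measure ℝ) +
      ENNReal.ofReal (2 * r / (1 + 2 * r)) • Measure.dirac (1 / 2), by
    constructor
    simp only [Measure.coe_add, Measure.coe_smul, Pi.add_apply, Pi.smul_apply, measure_univ,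
      smul_eq_mul, mul_one]
    rw [← ENNReal.ofReal_add (by positivity) (by positivity), ← add_div,
      div_self (by positivity), ENNReal.ofReal_one]⟩

/-- `d` is a metric on the probability measures which induces the topology of weak
convergence. -/
structure IsWeakMetric (d : ProbabilityMeasure ℝ → ProbabilityMeasure ℝ → ℝ) : Prop where
  eq_zero_iff : ∀ μ ν, d μ ν = 0 ↔ μ = ν
  symm : ∀ μ ν, d μ ν = d ν μ
  triangle : ∀ μ ν ρ, d μ ρ ≤ d μ ν + d ν ρ
  nhds_basis : ∀ μ, (𝓝 μ).HasBasis (fun ε : ℝ => 0 < ε) (fun ε => {ν | d ν μ < ε})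

end

/-! Write `s = 2 + a` and `e = r * a`. The map is symmetric about `1/2`, so `W = L ∘ F` with `F x =
|x - 1/2|` and `L = foldLift`. Its factor `T = F ∘ L` on `[0, 1/2]` has three full affine branches
and one partial branch, `[0, e/s]`, which covers only `[0, e]`. An invariant `μ` of `W` equals `L_*
(F_* μ)`, and `F_* μ` is invariant under `T`; thus everything reduces to `T`.

Uniqueness and exactness: `integral_comp_foldMap` expresses the integral of `φ ∘ T` over `[0, u]`
through initial integrals of `φ`. The discrepancy of such an integral from `2u` times the total then
satisfies a recursion with factor at most `1/s + max (1/s) (1/k) < 1`, where `k` is the outer slope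
(the first summand drops out when `e = 0`). The contraction is uniform in `φ`, so any two absolutely
continuous probability measures merge in total variation under `T`.

Invariant density: for `s > 2` it is, up to normalisation, `c + ∑ w_n 1_{[0, t_n]}`, with `t_n = T^n
e`, `w_n` the reciprocal derivative of `T^n` at `e`, and `c = s - ∑ w_n`. It is at least `s - 2`,
which gives equivalence with Lebesgue measure.

Limit `a → 0`: the second branch has the fixed point `p = ra/(1+a)`, and `t_n = p (1 + a s^n)`, `w_n
= s^{-n}` until the orbit leaves that branch, by which time `s^{-n} = O(a^2)`. Divided by `a`, the
constant part tends to `2`, while the series puts mass `∑ r 2^{-n} = 2r` near `0`, hence near `1/2`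
after applying `L`. Dominated convergence (`tendsto_foldFunctional_div`) gives the weights `1 : 2r`.

Diagonal sequence: the limit measures for `r = n` tend to `δ_{1/2}`, hence so do the acims.
Concentration at `1/2` forces `n a_n → 0` (`peak_le_of_half_lt`), hence uniform convergence of the
maps; a common lower bound on the densities would keep mass on `[0, 1/4]`. -/

/-! ### The folded map and its four affine branches -/

/-- The slope of the outer branches of the folded map. -/
noncomputable def outerSlope (s e : ℝ) : ℝ := 2 * s / (s - 1 - 2 * e)

/-- The zero of the folded branches. -/
noncomputable def foldZero (s e : ℝ) : ℝ := (1 / 2 + e) / s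

/-- A symmetric `W`-shaped map, as a function of the distance to `1/2`. -/
noncomputable def foldLift (s e y : ℝ) : ℝ :=
  max (s * (foldZero s e - y)) (outerSlope s e * (y - foldZero s e))

/-- The factor of a symmetric `W`-shaped map under the folding `x ↦ |x - 1/2|`. -/
noncomputable def foldMap (s e y : ℝ) : ℝ := |foldLift s e y - 1 / 2|

/-- The reciprocal slope of the branch of `foldMap s e` that contains `u`. -/
noncomputable def branchCoeff (s e u : ℝ) : ℝ :=
  if u < e / s then -(1 / s)
  else if u < foldZero s e then 1 / s
  else if u < 1 / 2 - 1 / (2 * outerSlope s e) then -(1 / outerSlope s e)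
  else 1 / outerSlope s e

/-- The total reciprocal slope of the full branches of `foldMap s e` completed before `u`, where a
partial decreasing branch counts as completed. -/
noncomputable def fullCoeff (s e u : ℝ) : ℝ :=
  if u < foldZero s e then 0 else 1 / s + 1 / outerSlope s e

section fold

variable {s e : ℝ}

theorem outerSlope_gt_two (hs : 2 ≤ s) (he : 0 ≤ e) (he' : e < 1 / 2) : 2 < outerSlope s e := by
  unfold outerSlope
  rw [lt_div_iff₀ (by linarith)]
  linarith

/-- The outer branch carries an interval of length `1/2 - foldZero s e` affinely onto `[0, 1]`, so
that length is the reciprocal slope. -/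
theorem one_div_outerSlope (hs : 2 ≤ s) (he' : e < 1 / 2) :
    1 / outerSlope s e = 1 / 2 - foldZero s e := by
  have h1 : 0 < s - 1 - 2 * e := by linarith
  unfold outerSlope foldZero
  field_simp
  ring

theorem mul_foldZero (hs : 2 ≤ s) : s * foldZero s e = 1 / 2 + e := by
  unfold foldZero
  field_simp

theorem outerSlope_mul (hs : 2 ≤ s) (he : 0 ≤ e) (he' : e < 1 / 2) :
    outerSlope s e * (1 / 2 - foldZero s e) = 1 := by
  rw [← one_div_outerSlope hs he', mul_one_div_cancel]
  linarith [outerSlope_gt_two hs he he']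

theorem foldZero_pos (hs : 2 ≤ s) (he : 0 ≤ e) : 0 < foldZero s e := by
  unfold foldZero; positivity

theorem div_lt_foldZero (hs : 2 ≤ s) : e / s < foldZero s e := by
  unfold foldZero
  gcongr
  linarith

theorem foldZero_lt (hs : 2 ≤ s) (he : 0 ≤ e) (he' : e < 1 / 2) : foldZero s e < 1 / 2 := by
  have := one_div_outerSlope hs he'
  have h2 := outerSlope_gt_two hs he he'
  have : 0 < 1 / outerSlope s e := by positivity
  linarith

theorem continuous_foldLift : Continuous (foldLift s e) := by
  unfold foldLift; fun_prop

theorem continuous_foldMap : Continuous (foldMap s e) := by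
  unfold foldMap
  exact (continuous_foldLift.sub continuous_const).abs

theorem foldLift_of_le (hs : 2 ≤ s) (he : 0 ≤ e) (he' : e < 1 / 2) {y : ℝ}
    (hy : y ≤ foldZero s e) : foldLift s e y = 1 / 2 + e - s * y := by
  have h2 := outerSlope_gt_two hs he he'
  rw [foldLift, max_eq_left, mul_sub, mul_foldZero hs]
  nlinarith

theorem foldLift_of_ge (hs : 2 ≤ s) (he : 0 ≤ e) (he' : e < 1 / 2) {y : ℝ}
    (hy : foldZero s e ≤ y) : foldLift s e y = 1 - outerSlope s e * (1 / 2 - y) := by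
  have h2 := outerSlope_gt_two hs he he'
  have h3 := outerSlope_mul hs he he'
  rw [foldLift, max_eq_right]
  · linarith
  · nlinarith

theorem foldLift_mem (hs : 2 ≤ s) (he : 0 ≤ e) (he' : e < 1 / 2) {y : ℝ}
    (hy : y ∈ Icc (0 : ℝ) (1 / 2)) : foldLift s e y ∈ Icc (0 : ℝ) 1 := by
  have h2 := outerSlope_gt_two hs he he'
  have h3 := outerSlope_mul hs he he'
  have h4 := mul_foldZero (e := e) hs
  rcases le_total y (foldZero s e) with h | h
  · rw [foldLift_of_le hs he he' h]
    constructor <;> nlinarith [hy.1]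
  · rw [foldLift_of_ge hs he he' h]
    constructor <;> nlinarith [hy.2]

theorem abs_sub_half_mem {x : ℝ} (hx : x ∈ Icc (0 : ℝ) 1) : |x - 1 / 2| ∈ Icc (0 : ℝ) (1 / 2) :=
  ⟨abs_nonneg _, abs_le.2 ⟨by linarith [hx.1], by linarith [hx.2]⟩⟩

theorem foldMap_mem (hs : 2 ≤ s) (he : 0 ≤ e) (he' : e < 1 / 2) {y : ℝ}
    (hy : y ∈ Icc (0 : ℝ) (1 / 2)) : foldMap s e y ∈ Icc (0 : ℝ) (1 / 2) :=
  abs_sub_half_mem (foldLift_mem hs he he' hy)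

theorem foldMap_branch_one (hs : 2 ≤ s) (he : 0 ≤ e) (he' : e < 1 / 2) {y : ℝ}
    (hy : y ≤ e / s) : foldMap s e y = e - s * y := by
  rw [foldMap, foldLift_of_le hs he he' (hy.trans (div_lt_foldZero hs).le), abs_of_nonneg]
  · ring
  · rw [le_div_iff₀ (by linarith)] at hy
    linarith

theorem foldMap_branch_two (hs : 2 ≤ s) (he : 0 ≤ e) (he' : e < 1 / 2) {y : ℝ}
    (hy : e / s ≤ y) (hy' : y ≤ foldZero s e) : foldMap s e y = s * y - e := by
  rw [foldMap, foldLift_of_le hs he he' hy', abs_of_nonpos]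
  · ring
  · rw [div_le_iff₀ (by linarith)] at hy
    linarith

theorem foldMap_branch_three (hs : 2 ≤ s) (he : 0 ≤ e) (he' : e < 1 / 2) {y : ℝ}
    (hy : foldZero s e ≤ y) (hy' : y ≤ 1 / 2 - 1 / (2 * outerSlope s e)) :
    foldMap s e y = outerSlope s e * (1 / 2 - y) - 1 / 2 := by
  have h2 := outerSlope_gt_two hs he he'
  have : 1 / 2 ≤ outerSlope s e * (1 / 2 - y) := by
    have : 1 / (2 * outerSlope s e) ≤ 1 / 2 - y := by linarith
    rw [div_le_iff₀ (by linarith)] at this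
    linarith
  rw [foldMap, foldLift_of_ge hs he he' hy, abs_of_nonpos] <;> linarith

theorem foldMap_branch_four (hs : 2 ≤ s) (he : 0 ≤ e) (he' : e < 1 / 2) {y : ℝ}
    (hy' : 1 / 2 - 1 / (2 * outerSlope s e) ≤ y) :
    foldMap s e y = 1 / 2 - outerSlope s e * (1 / 2 - y) := by
  have h2 := outerSlope_gt_two hs he he'
  have hy : foldZero s e ≤ y := by
    have h1 := one_div_outerSlope (s := s) (e := e) hs he'
    have : 1 / (2 * outerSlope s e) = (1 / outerSlope s e) / 2 := by field_simp
    have : 0 < 1 / outerSlope s e := by positivity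
    linarith
  have : outerSlope s e * (1 / 2 - y) ≤ 1 / 2 := by
    have : 1 / 2 - y ≤ 1 / (2 * outerSlope s e) := by linarith
    rw [le_div_iff₀ (by linarith)] at this
    linarith
  rw [foldMap, foldLift_of_ge hs he he' hy, abs_of_nonneg] <;> linarith

end fold

/-! ### Initial integrals of observables composed with the folded map -/

theorem intervalIntegrable_of_bounded {φ : ℝ → ℝ} {M : ℝ} (hφ : Measurable φ)
    (hM : ∀ x, |φ x| ≤ M) (a b : ℝ) : IntervalIntegrable φ volume a b :=
  (intervalIntegrable_const (c := M)).mono_fun hφ.aestronglyMeasurable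
    (Eventually.of_forall fun x => (hM x).trans (le_abs_self M))

section transfer

variable {s e : ℝ} {φ : ℝ → ℝ} {M : ℝ}

theorem integral_foldMap_branch_one (hs : 2 ≤ s) (he : 0 ≤ e) (he' : e < 1 / 2)
    (hφ : Measurable φ) (hM : ∀ x, |φ x| ≤ M) {u : ℝ} (hu : 0 ≤ u) (hu' : u ≤ e / s) :
    ∫ y in (0 : ℝ)..u, φ (foldMap s e y)
      = 1 / s * (∫ y in (0 : ℝ)..e, φ y) - 1 / s * ∫ y in (0 : ℝ)..foldMap s e u, φ y := by
  have hi := intervalIntegrable_of_bounded hφ hM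
  rw [foldMap_branch_one hs he he' hu', ← mul_sub,
    intervalIntegral.integral_interval_sub_left (hi _ _) (hi _ _)]
  calc ∫ y in (0 : ℝ)..u, φ (foldMap s e y) = ∫ y in (0 : ℝ)..u, φ (e - s * y) := by
        refine intervalIntegral.integral_congr fun y hy => ?_
        rw [uIcc_of_le hu] at hy
        simp only [foldMap_branch_one hs he he' (hy.2.trans hu')]
    _ = _ := by
        rw [intervalIntegral.integral_comp_sub_mul φ (by linarith : s ≠ 0 )]
        simp

theorem integral_foldMap_branch_two (hs : 2 ≤ s) (he : 0 ≤ e) (he' : e < 1 / 2) {u : ℝ} (hu : e / s ≤ u)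
    (hu' : u ≤ foldZero s e) :
    ∫ y in (e / s)..u, φ (foldMap s e y) = 1 / s * ∫ y in (0 : ℝ)..foldMap s e u, φ y := by
  rw [foldMap_branch_two hs he he' hu hu']
  calc ∫ y in (e / s)..u, φ (foldMap s e y) = ∫ y in (e / s)..u, φ (s * y - e) := by
        refine intervalIntegral.integral_congr fun y hy => ?_
        rw [uIcc_of_le hu] at hy
        simp only [foldMap_branch_two hs he he' hy.1 (hy.2.trans hu')]
    _ = _ := by
        rw [intervalIntegral.integral_comp_mul_sub φ (by linarith : s ≠ 0), smul_eq_mul, one_div,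
          mul_div_cancel₀ _ (by linarith : s ≠ 0), sub_self]

theorem integral_foldMap_branch_three (hs : 2 ≤ s) (he : 0 ≤ e) (he' : e < 1 / 2)
    (hφ : Measurable φ) (hM : ∀ x, |φ x| ≤ M) {u : ℝ} (hu : foldZero s e ≤ u)
    (hu' : u ≤ 1 / 2 - 1 / (2 * outerSlope s e)) :
    ∫ y in (foldZero s e)..u, φ (foldMap s e y)
      = 1 / outerSlope s e * (∫ y in (0 : ℝ)..(1 / 2), φ y)
        - 1 / outerSlope s e * ∫ y in (0 : ℝ)..foldMap s e u, φ y := by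
  have hi := intervalIntegrable_of_bounded hφ hM
  have h2 := outerSlope_gt_two hs he he'
  have h3 := outerSlope_mul hs he he'
  rw [foldMap_branch_three hs he he' hu hu', ← mul_sub,
    intervalIntegral.integral_interval_sub_left (hi _ _) (hi _ _)]
  calc ∫ y in (foldZero s e)..u, φ (foldMap s e y)
      = ∫ y in (foldZero s e)..u, φ ((outerSlope s e / 2 - 1 / 2) - outerSlope s e * y) := by
        refine intervalIntegral.integral_congr fun y hy => ?_
        rw [uIcc_of_le hu] at hy
        simp only [foldMap_branch_three hs he he' hy.1 (hy.2.trans hu')]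
        congr 1
        ring
    _ = _ := by
        rw [intervalIntegral.integral_comp_sub_mul φ (by linarith), smul_eq_mul, ← one_div]
        congr 2 <;> linarith

theorem integral_foldMap_branch_four (hs : 2 ≤ s) (he : 0 ≤ e) (he' : e < 1 / 2) {u : ℝ}
    (hu : 1 / 2 - 1 / (2 * outerSlope s e) ≤ u) :
    ∫ y in (1 / 2 - 1 / (2 * outerSlope s e))..u, φ (foldMap s e y)
      = 1 / outerSlope s e * ∫ y in (0 : ℝ)..foldMap s e u, φ y := by
  have h2 := outerSlope_gt_two hs he he'
  have h4 : outerSlope s e * (1 / (2 * outerSlope s e)) = 1 / 2 := by field_simp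
  rw [foldMap_branch_four hs he he' hu]
  calc ∫ y in (1 / 2 - 1 / (2 * outerSlope s e))..u, φ (foldMap s e y)
      = ∫ y in (1 / 2 - 1 / (2 * outerSlope s e))..u,
          φ (outerSlope s e * y - (outerSlope s e / 2 - 1 / 2)) := by
        refine intervalIntegral.integral_congr fun y hy => ?_
        rw [uIcc_of_le hu] at hy
        simp only [foldMap_branch_four hs he he' hy.1]
        congr 1
        ring
    _ = _ := by
        rw [intervalIntegral.integral_comp_mul_sub φ (by linarith), smul_eq_mul, ← one_div]
        congr 2 <;> linarith

/-- The dual transfer operator of `foldMap s e` on indicators of initial intervals. -/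
theorem integral_comp_foldMap (hs : 2 ≤ s) (he : 0 ≤ e) (he' : e < 1 / 2)
    (hφ : Measurable φ) (hM : ∀ x, |φ x| ≤ M) {u : ℝ} (hu : u ∈ Icc (0 : ℝ) (1 / 2)) :
    ∫ y in (0 : ℝ)..u, φ (foldMap s e y)
      = fullCoeff s e u * (∫ y in (0 : ℝ)..(1 / 2), φ y) + 1 / s * (∫ y in (0 : ℝ)..e, φ y)
        + branchCoeff s e u * ∫ y in (0 : ℝ)..foldMap s e u, φ y := by
  have h2 := outerSlope_gt_two hs he he'
  have hk : 0 < 1 / (2 * outerSlope s e) := by positivity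
  have hk2 : 1 / (2 * outerSlope s e) = (1 / outerSlope s e) / 2 := by field_simp
  have hz := one_div_outerSlope (s := s) (e := e) hs he'
  have hes : 0 ≤ e / s := by positivity
  have hb := div_lt_foldZero (e := e) hs
  have hi := intervalIntegrable_of_bounded (hφ.comp (continuous_foldMap (s := s) (e := e)).measurable)
    (fun x => hM _)
  simp only [Function.comp_def] at hi
  -- The branch end points go to `0` or `1/2`, so every completed branch contributes a multiple of
  -- the integral over `[0, e]` or `[0, 1/2]`.
  have t0 : foldMap s e (e / s) = 0 := by
    rw [foldMap_branch_one hs he he' le_rfl]; field_simp; ring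
  have t1 : foldMap s e (foldZero s e) = 1 / 2 := by
    rw [foldMap_branch_two hs he he' hb.le le_rfl, mul_foldZero hs]; ring
  have t2 : foldMap s e (1 / 2 - 1 / (2 * outerSlope s e)) = 0 := by
    rw [foldMap_branch_four hs he he' le_rfl]; field_simp; ring
  have i1 := integral_foldMap_branch_one hs he he' hφ hM hes le_rfl
  have i2 := integral_foldMap_branch_two (φ := φ) hs he he' hb.le le_rfl
  have i3 := integral_foldMap_branch_three hs he he' hφ hM
    (u := 1 / 2 - 1 / (2 * outerSlope s e)) (by linarith) le_rfl
  simp only [t0, t1, t2, intervalIntegral.integral_same, mul_zero, sub_zero] at i1 i2 i3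
  unfold fullCoeff branchCoeff
  by_cases c1 : u < e / s
  · rw [if_pos (c1.trans hb), if_pos c1,
      integral_foldMap_branch_one hs he he' hφ hM hu.1 c1.le]
    ring
  rw [if_neg c1]
  push Not at c1
  by_cases c2 : u < foldZero s e
  · rw [if_pos c2, if_pos c2, ← intervalIntegral.integral_add_adjacent_intervals (hi 0 (e / s)) (hi _ _),
      integral_foldMap_branch_two hs he he' c1 c2.le, i1]
    ring
  rw [if_neg c2, if_neg c2]
  push Not at c2
  by_cases c3 : u < 1 / 2 - 1 / (2 * outerSlope s e)
  · rw [if_pos c3, ← intervalIntegral.integral_add_adjacent_intervals (hi 0 (e / s)) (hi _ _),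
      ← intervalIntegral.integral_add_adjacent_intervals (hi (e / s) (foldZero s e)) (hi _ _),
      integral_foldMap_branch_three hs he he' hφ hM c2 c3.le, i1, i2]
    ring
  · rw [if_neg c3]
    push Not at c3
    rw [← intervalIntegral.integral_add_adjacent_intervals (hi 0 (e / s)) (hi _ _),
      ← intervalIntegral.integral_add_adjacent_intervals (hi (e / s) (foldZero s e)) (hi _ _),
      ← intervalIntegral.integral_add_adjacent_intervals
        (hi (foldZero s e) (1 / 2 - 1 / (2 * outerSlope s e))) (hi _ _),
      integral_foldMap_branch_four hs he he' c3, i1, i2, i3]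
    ring

theorem foldMap_half (hs : 2 ≤ s) (he : 0 ≤ e) (he' : e < 1 / 2) :
    foldMap s e (1 / 2) = 1 / 2 := by
  have h2 := outerSlope_gt_two hs he he'
  have hk : 0 < 1 / (2 * outerSlope s e) := by positivity
  rw [foldMap_branch_four hs he he' (by linarith)]
  ring

/-- This is the transfer identity for the constant observable; it serves to eliminate `fullCoeff`.
-/
theorem fullCoeff_balance (hs : 2 ≤ s) (he : 0 ≤ e) (he' : e < 1 / 2) {u : ℝ}
    (hu : u ∈ Icc (0 : ℝ) (1 / 2)) :
    u = fullCoeff s e u * (1 / 2) + e / s + branchCoeff s e u * foldMap s e u := by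
  have := integral_comp_foldMap (φ := fun _ => 1) (M := 1) hs he he' measurable_const (by simp) hu
  simp only [intervalIntegral.integral_const, sub_zero, smul_eq_mul, mul_one] at this
  linear_combination this

/-- The full branches together would preserve normalised Lebesgue measure; the defect comes from the
partial branch alone and is `1/s` times the discrepancy of `φ` at `e`. -/
theorem integral_half_comp_foldMap (hs : 2 ≤ s) (he : 0 ≤ e) (he' : e < 1 / 2)
    (hφ : Measurable φ) (hM : ∀ x, |φ x| ≤ M) :
    ∫ y in (0 : ℝ)..(1 / 2), φ (foldMap s e y)
      = (∫ y in (0 : ℝ)..(1 / 2), φ y)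
        + 1 / s * ((∫ y in (0 : ℝ)..e, φ y) - 2 * e * ∫ y in (0 : ℝ)..(1 / 2), φ y) := by
  have hm : (1 / 2 : ℝ) ∈ Icc (0 : ℝ) (1 / 2) := by norm_num
  have h1 := integral_comp_foldMap hs he he' hφ hM hm
  have h2 := fullCoeff_balance hs he he' hm
  rw [foldMap_half hs he he'] at h1 h2
  rw [h1]
  linear_combination (-2 * ∫ y in (0 : ℝ)..(1 / 2), φ y) * h2

theorem abs_branchCoeff_le (hs : 2 ≤ s) (he : 0 ≤ e) (he' : e < 1 / 2) {γ : ℝ}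
    (h1 : 1 / s ≤ γ) (h2 : 1 / outerSlope s e ≤ γ) (u : ℝ) : |branchCoeff s e u| ≤ γ := by
  have hk := outerSlope_gt_two hs he he'
  have p1 : 0 < 1 / s := by positivity
  have p2 : 0 < 1 / outerSlope s e := by positivity
  unfold branchCoeff
  split_ifs <;> simp only [abs_neg, abs_of_pos p1, abs_of_pos p2, h1, h2]

end transfer

/-! ### Exponential decay of discrepancies -/

section contraction

variable {s e : ℝ}

/-- Integrals over initial intervals of iterated observables equidistribute exponentially fast,
uniformly in the observable. -/
theorem exists_discrepancy_le (hs : 2 ≤ s) (he : 0 ≤ e) (he' : e < 1 / 2) (h : e = 0 ∨ 2 < s) :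
    ∃ κ : ℝ, 0 ≤ κ ∧ κ < 1 ∧ ∀ (n : ℕ) (φ : ℝ → ℝ), Measurable φ → (∀ x, |φ x| ≤ 1) →
      ∀ u ∈ Icc (0 : ℝ) (1 / 2),
        |(∫ y in (0 : ℝ)..u, φ ((foldMap s e)^[n] y))
          - 2 * u * ∫ y in (0 : ℝ)..(1 / 2), φ ((foldMap s e)^[n] y)| ≤ κ ^ n := by
  have hk := outerSlope_gt_two hs he he'
  have p1 : 0 < 1 / s := by positivity
  have q1 : 1 / s ≤ 1 / 2 := one_div_le_one_div_of_le (by norm_num) hs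
  have q2 : 1 / outerSlope s e < 1 / 2 := one_div_lt_one_div_of_lt (by norm_num) hk
  set γ := max (1 / s) (1 / outerSlope s e) with hγ
  have hσ := abs_branchCoeff_le hs he he' (le_max_left (1 / s) (1 / outerSlope s e))
    (le_max_right _ _)
  rw [← hγ] at hσ
  -- `η` is the cost of the partial branch. For `e = 0` the discrepancy at `e` is an integral over a
  -- point and costs nothing, which rescues the slope `s = 2`.
  obtain ⟨η, hη0, hη, hη1⟩ : ∃ η : ℝ, 0 ≤ η ∧ (e = 0 ∨ 1 / s ≤ η) ∧ η + γ < 1 := by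
    rcases h with h | h
    · exact ⟨0, le_rfl, Or.inl h, by rw [zero_add]; exact max_lt (by linarith) (by linarith)⟩
    · have q1' : 1 / s < 1 / 2 := one_div_lt_one_div_of_lt (by norm_num) h
      exact ⟨1 / s, p1.le, Or.inr le_rfl, by linarith [max_lt q1' q2]⟩
  have hγ0 : 0 ≤ γ := p1.le.trans (le_max_left _ _)
  refine ⟨η + γ, by positivity, hη1, ?_⟩
  intro n
  induction n with
  | zero =>
    intro φ hφ hM u hu
    have b1 : ∀ v : ℝ, 0 ≤ v → |∫ y in (0 : ℝ)..v, φ y| ≤ v := fun v hv => by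
      have := intervalIntegral.norm_integral_le_of_norm_le_const (a := 0) (b := v) (C := 1)
        (f := φ) (fun x _ => hM x)
      rwa [sub_zero, abs_of_nonneg hv, one_mul] at this
    have c1 := abs_le.1 (b1 u hu.1)
    have c2 := abs_le.1 (b1 (1 / 2) (by norm_num))
    simp only [Function.iterate_zero, id, pow_zero]
    rw [abs_le]
    constructor <;> nlinarith [hu.1, hu.2]
  | succ n ih =>
    intro φ hφ hM u hu
    simp only [Function.iterate_succ_apply]
    set ψ : ℝ → ℝ := fun y => φ ((foldMap s e)^[n] y) with hψ
    have hψm : Measurable ψ := hφ.comp (continuous_foldMap.measurable.iterate n)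
    have hψM : ∀ x, |ψ x| ≤ 1 := fun x => hM _
    have i1 := integral_comp_foldMap hs he he' hψm hψM hu
    have i2 := integral_half_comp_foldMap hs he he' hψm hψM
    have bal := fullCoeff_balance hs he he' hu
    -- The recursion `D' u = (1 - 2u) / s * D e + branchCoeff u * D (T u)` for the discrepancy `D`.
    have key : (∫ y in (0 : ℝ)..u, ψ (foldMap s e y))
          - 2 * u * (∫ y in (0 : ℝ)..(1 / 2), ψ (foldMap s e y))
        = (1 - 2 * u) * (1 / s * ((∫ y in (0 : ℝ)..e, ψ y)
            - 2 * e * ∫ y in (0 : ℝ)..(1 / 2), ψ y))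
          + branchCoeff s e u * ((∫ y in (0 : ℝ)..foldMap s e u, ψ y)
            - 2 * foldMap s e u * ∫ y in (0 : ℝ)..(1 / 2), ψ y) := by
      rw [i1, i2]
      linear_combination (-2 * ∫ y in (0 : ℝ)..(1 / 2), ψ y) * bal
    have e1 := ih φ hφ hM e ⟨he, he'.le⟩
    have e2 := ih φ hφ hM _ (foldMap_mem hs he he' hu)
    change |(∫ y in (0 : ℝ)..u, ψ (foldMap s e y))
          - 2 * u * (∫ y in (0 : ℝ)..(1 / 2), ψ (foldMap s e y))| ≤ _
    rw [key]
    have f1 : |1 / s * ((∫ y in (0 : ℝ)..e, ψ y) - 2 * e * ∫ y in (0 : ℝ)..(1 / 2), ψ y)|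
        ≤ η * (η + γ) ^ n := by
      rcases hη with h0 | h0
      · rw [h0]
        simp only [intervalIntegral.integral_same, mul_zero, zero_mul, sub_zero, abs_zero]
        positivity
      · rw [abs_mul, abs_of_pos p1]
        exact mul_le_mul h0 e1 (abs_nonneg _) hη0
    have f0 : |1 - 2 * u| ≤ 1 := abs_le.2 ⟨by linarith [hu.2], by linarith [hu.1]⟩
    calc _ ≤ _ := abs_add_le _ _
      _ ≤ 1 * (η * (η + γ) ^ n) + γ * (η + γ) ^ n := by
          rw [abs_mul, abs_mul (branchCoeff s e u)]
          gcongr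
          exact hσ u
      _ = (η + γ) ^ (n + 1) := by ring

end contraction

/-! ### Uniform mixing: from initial intervals to all integrable densities -/

/-- The density `h` on `(0, 1/2]` is asymptotically equivalent under `T` to a multiple of Lebesgue
measure, uniformly over bounded observables. -/
def UniformlyMixes (T : ℝ → ℝ) (h : ℝ → ℝ) : Prop :=
  ∀ δ : ℝ, 0 < δ → ∃ N : ℕ, ∀ n ≥ N, ∀ φ : ℝ → ℝ, Measurable φ → (∀ x, |φ x| ≤ 1) →
    |(∫ y in Ioc (0 : ℝ) (1 / 2), h y * φ (T^[n] y))
      - 2 * (∫ y in Ioc (0 : ℝ) (1 / 2), h y) * ∫ y in Ioc (0 : ℝ) (1 / 2), φ (T^[n] y)| ≤ δ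

namespace UniformlyMixes

variable {T : ℝ → ℝ} {h g : ℝ → ℝ}

theorem integrable_mul_bounded {α : Type*} [MeasurableSpace α] {μ : Measure α} {h φ : α → ℝ}
    (hh : Integrable h μ) (hφ : Measurable φ) (hM : ∀ x, |φ x| ≤ 1) :
    Integrable (fun y => h y * φ y) μ :=
  hh.mul_bdd (c := 1) hφ.aestronglyMeasurable (Eventually.of_forall hM)

theorem abs_setIntegral_le_half {φ : ℝ → ℝ} (hM : ∀ x, |φ x| ≤ 1) :
    |∫ y in Ioc (0 : ℝ) (1 / 2), φ y| ≤ 1 / 2 := by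
  have := norm_setIntegral_le_of_norm_le_const (μ := volume) (s := Ioc (0 : ℝ) (1 / 2)) (f := φ)
    (C := 1) (by simp) (fun x _ => hM x)
  simpa using this

theorem add (hT : Measurable T) (hi : IntegrableOn h (Ioc 0 (1 / 2)))
    (gi : IntegrableOn g (Ioc 0 (1 / 2)))
    (hh : UniformlyMixes T h) (hg : UniformlyMixes T g) : UniformlyMixes T (fun x => h x + g x) := by
  intro δ hδ
  obtain ⟨N₁, h₁⟩ := hh (δ / 2) (by positivity)
  obtain ⟨N₂, h₂⟩ := hg (δ / 2) (by positivity)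
  refine ⟨max N₁ N₂, fun n hn φ hφ hM => ?_⟩
  have a₁ := h₁ n (le_of_max_le_left hn) φ hφ hM
  have a₂ := h₂ n (le_of_max_le_right hn) φ hφ hM
  have m : Measurable fun y => φ (T^[n] y) := hφ.comp (hT.iterate n)
  simp only [add_mul]
  rw [integral_add (integrable_mul_bounded hi m fun _ => hM _)
    (integrable_mul_bounded gi m fun _ => hM _), integral_add hi gi]
  rw [abs_le] at *
  constructor <;> linarith

theorem const_mul (c : ℝ) (hh : UniformlyMixes T h) : UniformlyMixes T (fun x => c * h x) := by
  intro δ hδ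
  obtain ⟨N, h₁⟩ := hh (δ / (|c| + 1)) (by positivity)
  refine ⟨N, fun n hn φ hφ hM => ?_⟩
  have a₁ := h₁ n hn φ hφ hM
  simp only [mul_assoc]
  rw [integral_const_mul, integral_const_mul]
  have comm : ∀ a b w : ℝ, c * a - 2 * (c * b * w) = c * (a - 2 * (b * w)) := by
    intros; ring
  rw [mul_assoc 2] at a₁
  rw [comm, abs_mul]
  calc _ ≤ |c| * (δ / (|c| + 1)) := by gcongr
    _ ≤ δ := by
        rw [mul_div_assoc', div_le_iff₀ (by positivity)]
        nlinarith [abs_nonneg c]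

theorem one : UniformlyMixes T (fun _ => 1) := by
  intro δ hδ
  refine ⟨0, fun n _ φ hφ hM => ?_⟩
  simp [hδ.le]

/-- An `L¹` error in the density changes both terms by an amount independent of `n` and `φ`, because
`|φ| ≤ 1`. The errors add up to `δ/2 + δ/4 + 2 · (δ/4) · (1/2) = δ`. -/
theorem of_approx (hT : Measurable T) (hi : IntegrableOn h (Ioc 0 (1 / 2)))
    (H : ∀ δ : ℝ, 0 < δ → ∃ g : ℝ → ℝ, IntegrableOn g (Ioc 0 (1 / 2)) ∧ UniformlyMixes T g ∧
      ∫ y in Ioc (0 : ℝ) (1 / 2), |h y - g y| ≤ δ) : UniformlyMixes T h := by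
  intro δ hδ
  obtain ⟨g, gi, hg, hgh⟩ := H (δ / 4) (by positivity)
  obtain ⟨N, h₁⟩ := hg (δ / 2) (by positivity)
  refine ⟨N, fun n hn φ hφ hM => ?_⟩
  have a₁ := h₁ n hn φ hφ hM
  have m : Measurable fun y => φ (T^[n] y) := hφ.comp (hT.iterate n)
  have hM' : ∀ y, |φ (T^[n] y)| ≤ 1 := fun _ => hM _
  have w := abs_setIntegral_le_half hM'
  have d1 : |(∫ y in Ioc (0 : ℝ) (1 / 2), h y * φ (T^[n] y))
      - ∫ y in Ioc (0 : ℝ) (1 / 2), g y * φ (T^[n] y)| ≤ δ / 4 := by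
    rw [← integral_sub (integrable_mul_bounded hi m hM') (integrable_mul_bounded gi m hM')]
    refine abs_integral_le_integral_abs.trans (le_trans ?_ hgh)
    refine integral_mono ((integrable_mul_bounded hi m hM').sub
      (integrable_mul_bounded gi m hM')).abs (Integrable.abs (hi.sub gi)) fun y => ?_
    simp only [← sub_mul, abs_mul]
    exact mul_le_of_le_one_right (abs_nonneg _) (hM' y)
  have d2 : |(∫ y in Ioc (0 : ℝ) (1 / 2), h y) - ∫ y in Ioc (0 : ℝ) (1 / 2), g y| ≤ δ / 4 := by
    rw [← integral_sub hi gi]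
    exact abs_integral_le_integral_abs.trans hgh
  have d3 : |((∫ y in Ioc (0 : ℝ) (1 / 2), h y) - ∫ y in Ioc (0 : ℝ) (1 / 2), g y)
      * ∫ y in Ioc (0 : ℝ) (1 / 2), φ (T^[n] y)| ≤ δ / 4 * (1 / 2) := by
    rw [abs_mul]; gcongr
  rw [abs_le] at *
  constructor <;> linarith

theorem indicator_Iic {s e : ℝ} (hs : 2 ≤ s) (he : 0 ≤ e) (he' : e < 1 / 2)
    (h : e = 0 ∨ 2 < s) (u : ℝ) : UniformlyMixes (foldMap s e) ((Iic u).indicator fun _ => 1) := by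
  obtain ⟨κ, k0, k1, hκ⟩ := exists_discrepancy_le hs he he' h
  intro δ hδ
  obtain ⟨N, hN⟩ := exists_pow_lt_of_lt_one hδ k1
  refine ⟨N, fun n hn φ hφ hM => ?_⟩
  -- Only the part of `Iic u` inside `(0, 1/2]` matters, so `u` is clamped to that interval.
  set c := max 0 (min u (1 / 2)) with hc
  have hc1 : c ∈ Icc (0 : ℝ) (1 / 2) := ⟨le_max_left _ _, max_le (by norm_num) (min_le_right _ _)⟩
  have hset : Ioc (0 : ℝ) (1 / 2) ∩ Iic u = Ioc 0 c := by
    ext x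
    simp only [mem_inter_iff, mem_Ioc, mem_Iic, hc, le_max_iff, le_min_iff]
    grind
  have hI : ∀ ψ : ℝ → ℝ, ∫ y in Ioc (0 : ℝ) (1 / 2), (Iic u).indicator (fun _ => (1 : ℝ)) y * ψ y
      = ∫ y in (0 : ℝ)..c, ψ y := fun ψ => by
    rw [intervalIntegral.integral_of_le hc1.1, ← hset, ← setIntegral_indicator measurableSet_Iic]
    congr 1 with y
    by_cases hy : y ∈ Iic u <;> simp [hy]
  have h2 := hI fun _ => 1
  simp only [mul_one, intervalIntegral.integral_const, sub_zero, smul_eq_mul] at h2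
  have h3 := hκ n φ hφ hM c hc1
  rw [hI fun y => φ ((foldMap s e)^[n] y), h2,
    ← intervalIntegral.integral_of_le (by norm_num : (0 : ℝ) ≤ 1 / 2)]
  exact h3.trans ((pow_le_pow_of_le_one k0 k1.le hn).trans hN.le)

/-- A π-λ argument from half-lines: complements and finite disjoint unions follow by linearity,
countable unions by `L¹` approximation. -/
theorem indicator (hT : Measurable T)
    (H : ∀ u : ℝ, UniformlyMixes T ((Iic u).indicator fun _ => 1)) {E : Set ℝ}
    (hE : MeasurableSet E) : UniformlyMixes T (E.indicator fun _ => 1) := by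
  have hint : ∀ {E : Set ℝ}, MeasurableSet E →
      IntegrableOn (E.indicator fun _ => (1 : ℝ)) (Ioc 0 (1 / 2)) := fun hE =>
    (integrable_const (1 : ℝ)).indicator hE
  induction E, hE using MeasurableSpace.induction_on_inter (borel_eq_generateFrom_Iic ℝ) isPiSystem_Iic with
  | empty => simpa using (one (T := T)).const_mul 0
  | basic t ht => obtain ⟨u, rfl⟩ := ht; exact H u
  | compl t ht ih =>
    have := one.add hT (integrable_const _) ((hint ht).const_mul (-1)) (ih.const_mul (-1))
    convert this using 2 with x
    by_cases hx : x ∈ t <;> simp [hx]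
  | iUnion f hd hf ih =>
    have hacc : ∀ n, MeasurableSet (accumulate f n) := fun n =>
      by
      rw [accumulate_def]
      exact MeasurableSet.biUnion (to_countable _) fun i _ => hf i
    have hmix : ∀ n, UniformlyMixes T ((accumulate f n).indicator fun _ => 1) := by
      intro n
      induction n with
      | zero => simpa using ih 0
      | succ n hn =>
        have := hn.add hT (hint (hacc n)) (hint (hf (n + 1))) (ih (n + 1))
        convert this using 1
        rw [accumulate_succ, indicator_union_of_disjoint]
        exact (disjoint_accumulate hd (Nat.lt_succ_self n))
    refine of_approx hT (hint (MeasurableSet.iUnion hf)) fun δ hδ => ?_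
    have ht : Tendsto (fun n => (volume.restrict (Ioc (0 : ℝ) (1 / 2))).real (accumulate f n)) atTop
        (𝓝 ((volume.restrict (Ioc (0 : ℝ) (1 / 2))).real (⋃ n, f n))) :=
      (ENNReal.tendsto_toReal (measure_ne_top _ _)).comp tendsto_measure_iUnion_accumulate
    obtain ⟨n, hn⟩ := (ht.eventually (lt_mem_nhds (sub_lt_self _ hδ))).exists
    refine ⟨_, hint (hacc n), hmix n, ?_⟩
    have hsub : accumulate f n ⊆ ⋃ n, f n := accumulate_subset_iUnion n
    have : (fun y => |(⋃ n, f n).indicator (fun _ => (1 : ℝ)) y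
        - (accumulate f n).indicator (fun _ => (1 : ℝ)) y|)
        = ((⋃ n, f n) \ accumulate f n).indicator fun _ => (1 : ℝ) := by
      rw [indicator_sdiff hsub]
      ext y
      refine abs_of_nonneg (sub_nonneg.2 ?_)
      exact indicator_le_indicator_of_subset hsub (fun _ => zero_le_one) y
    rw [this, integral_indicator_const _ ((MeasurableSet.iUnion hf).diff (hacc n)), smul_eq_mul,
      mul_one, measureReal_sdiff hsub (hacc n)]
    linarith

theorem of_integrable (hT : Measurable T)
    (H : ∀ u : ℝ, UniformlyMixes T ((Iic u).indicator fun _ => 1))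
    (hi : IntegrableOn h (Ioc 0 (1 / 2))) : UniformlyMixes T h := by
  refine Integrable.induction (μ := volume.restrict (Ioc (0 : ℝ) (1 / 2))) (UniformlyMixes T)
    ?_ ?_ ?_ ?_ hi
  · intro c E hE _
    have := (indicator hT H hE).const_mul c
    convert this using 2 with x
    by_cases hx : x ∈ E <;> simp [hx]
  · intro f g _ hf hg mf mg
    exact mf.add hT hf hg mg
  · refine isClosed_of_closure_subset fun f hf => ?_
    refine of_approx hT (L1.integrable_coeFn f) fun δ hδ => ?_
    obtain ⟨g, hg, hfg⟩ := Metric.mem_closure_iff.1 hf δ hδ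
    refine ⟨g, L1.integrable_coeFn g, hg, ?_⟩
    rw [L1.dist_eq_integral_dist] at hfg
    exact hfg.le
  · intro f g hfg hf mf
    refine of_approx hT (hf.congr hfg) fun δ hδ => ⟨f, hf, mf, ?_⟩
    rw [integral_congr_ae (g := fun _ => 0)]
    · simpa using hδ.le
    · filter_upwards [hfg] with x hx
      simp [hx]

end UniformlyMixes

/-! ### Uniqueness and exactness from mixing -/

/-- Any two absolutely continuous probability measures on `(0, 1/2]` merge in total variation. -/
theorem exists_abs_measureReal_preimage_sub_le {T : ℝ → ℝ} (hT : Measurable T)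
    (H : ∀ u : ℝ, UniformlyMixes T ((Iic u).indicator fun _ => 1))
    (ρ₁ ρ₂ : Measure ℝ) [IsProbabilityMeasure ρ₁] [IsProbabilityMeasure ρ₂]
    (h₁ : ρ₁ ≪ volume.restrict (Ioc (0 : ℝ) (1 / 2)))
    (h₂ : ρ₂ ≪ volume.restrict (Ioc (0 : ℝ) (1 / 2))) {δ : ℝ} (hδ : 0 < δ) :
    ∃ N : ℕ, ∀ n ≥ N, ∀ C : Set ℝ, MeasurableSet C →
      |ρ₁.real (T^[n] ⁻¹' C) - ρ₂.real (T^[n] ⁻¹' C)| ≤ δ := by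
  -- A probability density has integral `1`, so every `ρ` is compared with the same multiple of
  -- Lebesgue measure.
  have key : ∀ (ρ : Measure ℝ) [IsProbabilityMeasure ρ],
      ρ ≪ volume.restrict (Ioc (0 : ℝ) (1 / 2)) → ∃ N : ℕ, ∀ n ≥ N, ∀ C : Set ℝ,
        MeasurableSet C → |ρ.real (T^[n] ⁻¹' C) - 2 * ∫ y in Ioc (0 : ℝ) (1 / 2),
          C.indicator (fun _ => (1 : ℝ)) (T^[n] y)| ≤ δ / 2 := by
    intro ρ _ hρ
    have hi : IntegrableOn (fun y => (ρ.rnDeriv (volume.restrict (Ioc (0 : ℝ) (1 / 2))) y).toReal)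
        (Ioc 0 (1 / 2)) := Measure.integrable_toReal_rnDeriv
    obtain ⟨N, hN⟩ := UniformlyMixes.of_integrable hT H hi (δ / 2) (by positivity)
    refine ⟨N, fun n hn C hC => ?_⟩
    have := hN n hn (C.indicator fun _ => 1) (measurable_const.indicator hC) fun x => by
      by_cases hx : x ∈ C <;> simp [hx]
    have h1 := integral_rnDeriv_smul hρ (f := fun _ => (1 : ℝ))
    have h2 := integral_rnDeriv_smul hρ (f := fun y => C.indicator (fun _ => (1 : ℝ)) (T^[n] y))
    simp only [smul_eq_mul, mul_one, integral_const, probReal_univ] at h1 h2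
    have h3 : ∫ y, C.indicator (fun _ => (1 : ℝ)) (T^[n] y) ∂ρ = ρ.real (T^[n] ⁻¹' C) := by
      have : (fun y => C.indicator (fun _ => (1 : ℝ)) (T^[n] y))
          = (T^[n] ⁻¹' C).indicator fun _ => 1 := rfl
      rw [this, integral_indicator_const _ (hT.iterate n hC), smul_eq_mul, mul_one]
    rw [h1, h2, h3, mul_one] at this
    exact this
  obtain ⟨N₁, k₁⟩ := key ρ₁ h₁
  obtain ⟨N₂, k₂⟩ := key ρ₂ h₂
  refine ⟨max N₁ N₂, fun n hn C hC => ?_⟩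
  have a₁ := k₁ n (le_of_max_le_left hn) C hC
  have a₂ := k₂ n (le_of_max_le_right hn) C hC
  rw [abs_le] at *
  constructor <;> linarith

/-- Invariance makes the measures of `T^{-n} C` independent of `n`, so merging leaves no room for a
difference. -/
theorem eq_of_measurePreserving {T : ℝ → ℝ}
    (H : ∀ u : ℝ, UniformlyMixes T ((Iic u).indicator fun _ => 1))
    {ρ₁ ρ₂ : Measure ℝ} [IsProbabilityMeasure ρ₁] [IsProbabilityMeasure ρ₂]
    (h₁ : ρ₁ ≪ volume.restrict (Ioc (0 : ℝ) (1 / 2)))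
    (h₂ : ρ₂ ≪ volume.restrict (Ioc (0 : ℝ) (1 / 2)))
    (m₁ : MeasurePreserving T ρ₁ ρ₁) (m₂ : MeasurePreserving T ρ₂ ρ₂) : ρ₁ = ρ₂ := by
  ext C hC
  rw [← measureReal_eq_measureReal_iff]
  refine eq_of_forall_dist_le fun δ hδ => ?_
  obtain ⟨N, hN⟩ := exists_abs_measureReal_preimage_sub_le m₁.measurable H ρ₁ ρ₂ h₁ h₂ hδ
  have := hN N le_rfl C hC
  rwa [(m₁.iterate N).measureReal_preimage hC.nullMeasurableSet,
    (m₂.iterate N).measureReal_preimage hC.nullMeasurableSet] at this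

/-- Exactness of an absolutely continuous invariant measure. -/
theorem measure_eq_zero_or_one_of_mixes {T : ℝ → ℝ}
    (H : ∀ u : ℝ, UniformlyMixes T ((Iic u).indicator fun _ => 1))
    {ρ : Measure ℝ} [IsProbabilityMeasure ρ]
    (hρ : ρ ≪ volume.restrict (Ioc (0 : ℝ) (1 / 2))) (m : MeasurePreserving T ρ ρ)
    {A : Set ℝ} (hA' : ∀ n : ℕ, ∃ B : Set ℝ, MeasurableSet B ∧ A =ᵐ[ρ] (T^[n]) ⁻¹' B) :
    ρ A = 0 ∨ ρ A = 1 := by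
  refine or_iff_not_imp_left.2 fun h0 => ?_
  -- `ρ` is compared with `ρ` conditioned on `A`. Up to null sets `A = T^{-N} B`, so `ρ A` is within
  -- `δ` of the conditional measure `1`. As `B` varies with `N`, merging has to be uniform over
  -- sets.
  have : IsProbabilityMeasure (ProbabilityTheory.cond ρ A) :=
    ProbabilityTheory.cond_isProbabilityMeasure h0
  have hc : ProbabilityTheory.cond ρ A ≪ ρ := ProbabilityTheory.cond_absolutelyContinuous
  have hAr : ρ.real A = 1 := by
    refine eq_of_forall_dist_le fun δ hδ => ?_
    obtain ⟨N, hN⟩ := exists_abs_measureReal_preimage_sub_le m.measurable H ρ _ hρ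
      (hc.trans hρ) hδ
    obtain ⟨B, hB, hAB⟩ := hA' N
    have := hN N le_rfl B hB
    rwa [← measureReal_congr hAB, ← measureReal_congr (hc.ae_eq hAB), measureReal_def (ProbabilityTheory.cond ρ A),
      ProbabilityTheory.cond_apply_self h0 (measure_ne_top _ _), ENNReal.toReal_one] at this
  rw [measureReal_def, ENNReal.toReal_eq_one_iff] at hAr
  exact hAr

/-! ### The explicit invariant density -/

/-- The orbit of the critical value `e` under `foldMap s e`. -/
noncomputable def foldOrbit (s e : ℝ) (n : ℕ) : ℝ := (foldMap s e)^[n] e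

/-- The reciprocal derivative of `(foldMap s e)^[n]` at the critical value. -/
noncomputable def foldWeight (s e : ℝ) : ℕ → ℝ
  | 0 => 1
  | n + 1 => foldWeight s e n * branchCoeff s e (foldOrbit s e n)

/-- The constant part of the invariant density of `foldMap s e`. -/
noncomputable def foldConst (s e : ℝ) : ℝ := s - ∑' n, foldWeight s e n

/-- Integration against the (unnormalised) invariant density of `foldMap s e`. -/
noncomputable def foldFunctional (s e : ℝ) (φ : ℝ → ℝ) : ℝ :=
  foldConst s e * (∫ y in (0 : ℝ)..(1 / 2), φ y)
    + ∑' n, foldWeight s e n * ∫ y in (0 : ℝ)..foldOrbit s e n, φ y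

/-- The unnormalised invariant density of `foldMap s e`. -/
noncomputable def foldDensity (s e x : ℝ) : ℝ :=
  foldConst s e + ∑' n, foldWeight s e n * (Iic (foldOrbit s e n)).indicator (fun _ => 1) x

/-- The normalised absolutely continuous invariant measure of `foldMap s e`, for `2 < s`. -/
noncomputable def foldMeasure (s e : ℝ) : Measure ℝ :=
  (volume.restrict (Ioc (0 : ℝ) (1 / 2))).withDensity fun x =>
    ENNReal.ofReal (foldDensity s e x / foldFunctional s e fun _ => 1)

section orbit

variable {s e : ℝ}

theorem foldOrbit_succ (s e : ℝ) (n : ℕ) :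
    foldOrbit s e (n + 1) = foldMap s e (foldOrbit s e n) :=
  Function.iterate_succ_apply' _ _ _

theorem foldOrbit_mem (hs : 2 ≤ s) (he : 0 ≤ e) (he' : e < 1 / 2) (n : ℕ) :
    foldOrbit s e n ∈ Icc (0 : ℝ) (1 / 2) := by
  induction n with
  | zero => exact ⟨he, he'.le⟩
  | succ n ih => rw [foldOrbit_succ]; exact foldMap_mem hs he he' ih

theorem abs_foldWeight_le (hs : 2 ≤ s) (he : 0 ≤ e) (he' : e < 1 / 2) {γ : ℝ}
    (h1 : 1 / s ≤ γ) (h2 : 1 / outerSlope s e ≤ γ) (n : ℕ) : |foldWeight s e n| ≤ γ ^ n := by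
  have p1 : 0 < 1 / s := by positivity
  induction n with
  | zero => simp [foldWeight]
  | succ n ih =>
    rw [foldWeight, abs_mul, pow_succ]
    exact mul_le_mul ih (abs_branchCoeff_le hs he he' h1 h2 _) (abs_nonneg _)
      (pow_nonneg (p1.le.trans h1) n)

theorem abs_foldWeight_le_half (hs : 2 ≤ s) (he : 0 ≤ e) (he' : e < 1 / 2) (n : ℕ) :
    |foldWeight s e n| ≤ (1 / 2) ^ n :=
  abs_foldWeight_le hs he he' (one_div_le_one_div_of_le (by norm_num) hs)
    (one_div_le_one_div_of_le (by norm_num) (outerSlope_gt_two hs he he').le) n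

theorem summable_foldWeight_mul (hs : 2 ≤ s) (he : 0 ≤ e) (he' : e < 1 / 2) {x : ℕ → ℝ} {M : ℝ}
    (hx : ∀ n, |x n| ≤ M) : Summable fun n => foldWeight s e n * x n := by
  refine Summable.of_norm_bounded (summable_geometric_two.mul_right M) fun n => ?_
  rw [Real.norm_eq_abs, abs_mul]
  exact mul_le_mul (abs_foldWeight_le_half hs he he' n) (hx n) (abs_nonneg _) (by positivity)

theorem abs_tsum_foldWeight_mul_le (hs : 2 ≤ s) (he : 0 ≤ e) (he' : e < 1 / 2) {x : ℕ → ℝ} {M : ℝ}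
    (hx : ∀ n, |x n| ≤ M) : |∑' n, foldWeight s e n * x n| ≤ 2 * M := by
  rw [← Real.norm_eq_abs]
  refine tsum_of_norm_bounded (hasSum_geometric_two.mul_right M) fun n => ?_
  rw [Real.norm_eq_abs, abs_mul]
  exact mul_le_mul (abs_foldWeight_le_half hs he he' n) (hx n) (abs_nonneg _) (by positivity)

theorem abs_integral_initial_le {φ : ℝ → ℝ} {M : ℝ} (hM : ∀ x, |φ x| ≤ M) {u : ℝ}
    (hu : u ∈ Icc (0 : ℝ) (1 / 2)) : |∫ y in (0 : ℝ)..u, φ y| ≤ M := by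
  have := intervalIntegral.norm_integral_le_of_norm_le_const (a := 0) (b := u) (C := M)
    (f := φ) (fun x _ => hM x)
  rw [sub_zero, abs_of_nonneg hu.1] at this
  have h0 : 0 ≤ M := (abs_nonneg _).trans (hM 0)
  have := hu.1
  have := hu.2
  calc |∫ y in (0 : ℝ)..u, φ y| ≤ M * u := by assumption
    _ ≤ M := mul_le_of_le_one_right h0 (by linarith)

/-- The transfer identity at `t_n` turns the `n`-th term into the next one. The integrals over `[0,
e]` sum to `(∑ w_n)/s = 1 - c/s` times the one for `φ`: the `1` restores the zeroth term lost in the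
shift, and `-c/s` cancels the defect of the constant part. This is what dictates `c = s - ∑ w_n`. -/
theorem foldFunctional_comp_eq (hs : 2 ≤ s) (he : 0 ≤ e) (he' : e < 1 / 2) {φ : ℝ → ℝ} {M : ℝ}
    (hφ : Measurable φ) (hM : ∀ x, |φ x| ≤ M) :
    foldFunctional s e (fun y => φ (foldMap s e y)) - foldFunctional s e φ
      = (∑' n, foldWeight s e n * fullCoeff s e (foldOrbit s e n)
          - 2 * foldConst s e * e / s) * ∫ y in (0 : ℝ)..(1 / 2), φ y := by
  have hk := outerSlope_gt_two hs he he'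
  have p1 : 0 < 1 / s := by positivity
  have p2 : 0 < 1 / outerSlope s e := by positivity
  set Φ : ℝ → ℝ := fun u => ∫ y in (0 : ℝ)..u, φ y with hΦ
  have sA : Summable fun n => foldWeight s e n * fullCoeff s e (foldOrbit s e n) := by
    refine summable_foldWeight_mul (M := 1 / s + 1 / outerSlope s e) hs he he' fun n => ?_
    unfold fullCoeff
    split_ifs
    · rw [abs_zero]; positivity
    · rw [abs_of_pos (by positivity)]
  have s1 : Summable fun n => foldWeight s e n := by
    simpa using summable_foldWeight_mul (x := fun _ => 1) (M := 1) hs he he' (by simp)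
  have sB : Summable fun n => foldWeight s e n * Φ (foldOrbit s e n) :=
    summable_foldWeight_mul hs he he' fun n =>
      abs_integral_initial_le hM (foldOrbit_mem hs he he' n)
  have hterm : ∀ n, foldWeight s e n * (∫ y in (0 : ℝ)..foldOrbit s e n, φ (foldMap s e y))
      = foldWeight s e n * fullCoeff s e (foldOrbit s e n) * Φ (1 / 2)
        + foldWeight s e n * (1 / s * Φ e)
        + foldWeight s e (n + 1) * Φ (foldOrbit s e (n + 1)) := fun n => by
    rw [integral_comp_foldMap hs he he' hφ hM (foldOrbit_mem hs he he' n), foldWeight,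
      foldOrbit_succ]
    ring
  have hshift := sB.tsum_eq_zero_add
  have h0 : foldWeight s e 0 = 1 := rfl
  have h0' : foldOrbit s e 0 = e := rfl
  unfold foldFunctional
  rw [integral_half_comp_foldMap hs he he' hφ hM]
  simp only [hterm]
  rw [Summable.tsum_add ((sA.mul_right _).add (s1.mul_right _)) ((summable_nat_add_iff 1).2 sB),
    Summable.tsum_add (sA.mul_right _) (s1.mul_right _), tsum_mul_right, tsum_mul_right]
  rw [h0, h0', one_mul] at hshift
  have hc : ∑' n, foldWeight s e n = s - foldConst s e := by unfold foldConst; ring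
  rw [hc, hshift]
  have : s ≠ 0 := by linarith
  simp only [hΦ]
  field_simp
  ring

/-- The leftover coefficient does not depend on `φ`; for `φ = 1` the left side is `0`, so it
vanishes. -/
theorem foldFunctional_comp (hs : 2 ≤ s) (he : 0 ≤ e) (he' : e < 1 / 2) {φ : ℝ → ℝ} {M : ℝ}
    (hφ : Measurable φ) (hM : ∀ x, |φ x| ≤ M) :
    foldFunctional s e (fun y => φ (foldMap s e y)) = foldFunctional s e φ := by
  have h1 := foldFunctional_comp_eq hs he he' hφ hM
  have h2 := foldFunctional_comp_eq hs he he' (φ := fun _ => 1) (M := 1) measurable_const (by simp)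
  rw [sub_self, intervalIntegral.integral_const, sub_zero, smul_eq_mul, mul_one, eq_comm,
    mul_eq_zero, or_iff_left (by norm_num)] at h2
  rwa [h2, zero_mul, sub_eq_zero] at h1

theorem abs_indicator_one_le (E : Set ℝ) (x : ℝ) : |E.indicator (fun _ => (1 : ℝ)) x| ≤ 1 := by
  by_cases hx : x ∈ E <;> simp [hx]

theorem measurable_foldDensity (hs : 2 ≤ s) (he : 0 ≤ e) (he' : e < 1 / 2) :
    Measurable (foldDensity s e) := by
  refine measurable_const.add (measurable_of_tendsto_metrizable (f := fun (N : ℕ) x =>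
    ∑ n ∈ Finset.range N, foldWeight s e n * (Iic (foldOrbit s e n)).indicator (fun _ => 1) x)
    (fun N => ?_) (tendsto_pi_nhds.2 fun x => ?_))
  · exact Finset.measurable_sum _ fun n _ =>
      (measurable_const.indicator measurableSet_Iic).const_mul _
  · exact (summable_foldWeight_mul hs he he' fun n =>
      abs_indicator_one_le _ x).hasSum.tendsto_sum_nat

/-- The density is `s - ∑ w_n (1 - 1_{[0, t_n]})`, and `∑ |w_n| ≤ ∑ 2^{-n} = 2`. -/
theorem le_foldDensity (hs : 2 ≤ s) (he : 0 ≤ e) (he' : e < 1 / 2) (x : ℝ) :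
    s - 2 ≤ foldDensity s e x := by
  have s1 : Summable fun n => foldWeight s e n := by
    simpa using summable_foldWeight_mul (x := fun _ => 1) (M := 1) hs he he' (by simp)
  have s2 := summable_foldWeight_mul hs he he' fun n =>
    abs_indicator_one_le (Iic (foldOrbit s e n)) x
  have h : |∑' n, foldWeight s e n * (1 - (Iic (foldOrbit s e n)).indicator (fun _ => 1) x)|
      ≤ 2 * 1 := abs_tsum_foldWeight_mul_le hs he he' fun n => by
    by_cases hx : x ∈ Iic (foldOrbit s e n) <;> simp [hx]
  simp only [mul_sub, mul_one] at h
  rw [s1.tsum_sub s2, abs_le] at h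
  unfold foldDensity foldConst
  linarith

theorem abs_foldDensity_le (hs : 2 ≤ s) (he : 0 ≤ e) (he' : e < 1 / 2) (x : ℝ) :
    |foldDensity s e x| ≤ |foldConst s e| + 2 := by
  have h := abs_tsum_foldWeight_mul_le hs he he' fun n =>
    abs_indicator_one_le (Iic (foldOrbit s e n)) x
  unfold foldDensity
  exact (abs_add_le _ _).trans (by linarith)

theorem setIntegral_indicator_Iic_mul {u : ℝ} (hu : u ∈ Icc (0 : ℝ) (1 / 2)) (ψ : ℝ → ℝ) :
    ∫ y in Ioc (0 : ℝ) (1 / 2), (Iic u).indicator (fun _ => (1 : ℝ)) y * ψ y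
      = ∫ y in (0 : ℝ)..u, ψ y := by
  have hset : Ioc (0 : ℝ) (1 / 2) ∩ Iic u = Ioc 0 u := by
    ext x
    simp only [mem_inter_iff, mem_Ioc, mem_Iic]
    exact ⟨fun h => ⟨h.1.1, h.2⟩, fun h => ⟨⟨h.1, h.2.trans hu.2⟩, h.2⟩⟩
  rw [intervalIntegral.integral_of_le hu.1, ← hset, ← setIntegral_indicator measurableSet_Iic]
  congr 1 with y
  by_cases hy : y ∈ Iic u <;> simp [hy]

/-- Termwise integration, justified by the geometric bound on the weights. -/
theorem integral_foldDensity_mul (hs : 2 ≤ s) (he : 0 ≤ e) (he' : e < 1 / 2) {φ : ℝ → ℝ} {M : ℝ}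
    (hφ : Measurable φ) (hM : ∀ x, |φ x| ≤ M) :
    ∫ x in Ioc (0 : ℝ) (1 / 2), foldDensity s e x * φ x = foldFunctional s e φ := by
  have h0 : 0 ≤ M := (abs_nonneg _).trans (hM 0)
  have hφi : IntegrableOn φ (Ioc 0 (1 / 2)) :=
    (intervalIntegrable_of_bounded hφ hM 0 (1 / 2)).1
  set F : ℕ → ℝ → ℝ := fun n x =>
    foldWeight s e n * ((Iic (foldOrbit s e n)).indicator (fun _ => 1) x * φ x) with hF
  have hFb : ∀ n x, ‖F n x‖ ≤ (1 / 2) ^ n * M := fun n x => by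
    rw [Real.norm_eq_abs, abs_mul, abs_mul]
    refine mul_le_mul (abs_foldWeight_le_half hs he he' n) ?_ (by positivity) (by positivity)
    calc _ ≤ 1 * M := mul_le_mul (abs_indicator_one_le _ x) (hM x) (abs_nonneg _) zero_le_one
      _ = M := one_mul M
  have hFm : ∀ n, Measurable (F n) := fun n =>
    ((measurable_const.indicator measurableSet_Iic).mul hφ).const_mul _
  have hFi : ∀ n, IntegrableOn (F n) (Ioc 0 (1 / 2)) := fun n =>
    (integrable_const ((1 / 2) ^ n * M)).mono' (hFm n).aestronglyMeasurable
      (Eventually.of_forall (hFb n))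
  have hsum : Summable fun n => ∫ x in Ioc (0 : ℝ) (1 / 2), ‖F n x‖ := by
    refine Summable.of_nonneg_of_le (fun n => integral_nonneg fun x => norm_nonneg _) (fun n => ?_)
      ((summable_geometric_two.mul_right M).mul_right (1 / 2))
    calc _ ≤ ∫ x in Ioc (0 : ℝ) (1 / 2), (1 / 2) ^ n * M :=
          integral_mono (hFi n).norm (integrable_const _) (hFb n)
      _ = _ := by
        rw [setIntegral_const, smul_eq_mul, measureReal_def, Real.volume_Ioc, sub_zero,
          ENNReal.toReal_ofReal (by norm_num), mul_comm]
  have key := hasSum_integral_of_summable_integral_norm hFi hsum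
  have hFt : ∀ x, Summable fun n => F n x := fun x =>
    Summable.of_norm_bounded (summable_geometric_two.mul_right M) fun n => hFb n x
  have hti : IntegrableOn (fun x => ∑' n, F n x) (Ioc 0 (1 / 2)) := by
    refine (integrable_const (2 * M)).mono' (measurable_of_tendsto_metrizable
      (f := fun (N : ℕ) x => ∑ n ∈ Finset.range N, F n x)
      (fun N => Finset.measurable_sum _ fun n _ => hFm n) (tendsto_pi_nhds.2 fun x =>
        (hFt x).hasSum.tendsto_sum_nat)).aestronglyMeasurable (Eventually.of_forall fun x => ?_)
    exact tsum_of_norm_bounded (hasSum_geometric_two.mul_right M) fun n => hFb n x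
  have hpt : ∀ x, foldDensity s e x * φ x = foldConst s e * φ x + ∑' n, F n x := fun x => by
    rw [foldDensity, add_mul, ← tsum_mul_right]
    simp only [hF, mul_assoc]
  simp only [hpt]
  rw [integral_add (hφi.const_mul _) hti, integral_const_mul, ← key.tsum_eq, foldFunctional,
    ← intervalIntegral.integral_of_le (by norm_num)]
  congr 2 with n
  rw [integral_const_mul, setIntegral_indicator_Iic_mul (foldOrbit_mem hs he he' n)]

theorem foldFunctional_one_pos (hs : 2 < s) (he : 0 ≤ e) (he' : e < 1 / 2) :
    0 < foldFunctional s e fun _ => 1 := by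
  have h := integral_foldDensity_mul (φ := fun _ => 1) (M := 1) hs.le he he' measurable_const
    (by simp)
  simp only [mul_one] at h
  rw [← h]
  have : ∫ _ in Ioc (0 : ℝ) (1 / 2), (s - 2) ≤ ∫ x in Ioc (0 : ℝ) (1 / 2), foldDensity s e x := by
    refine integral_mono (integrable_const _) ?_ (le_foldDensity hs.le he he')
    exact (integrable_const (|foldConst s e| + 2)).mono'
      (measurable_foldDensity hs.le he he').aestronglyMeasurable
      (Eventually.of_forall (abs_foldDensity_le hs.le he he'))
  rw [setIntegral_const, measureReal_def, Real.volume_Ioc, sub_zero,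
    ENNReal.toReal_ofReal (by norm_num), smul_eq_mul] at this
  linarith

theorem integral_foldMeasure (hs : 2 < s) (he : 0 ≤ e) (he' : e < 1 / 2) {φ : ℝ → ℝ} {M : ℝ}
    (hφ : Measurable φ) (hM : ∀ x, |φ x| ≤ M) :
    ∫ x, φ x ∂foldMeasure s e = foldFunctional s e φ / foldFunctional s e fun _ => 1 := by
  have hp := foldFunctional_one_pos hs he he'
  unfold foldMeasure
  rw [integral_withDensity_eq_integral_toReal_smul
    (((measurable_foldDensity hs.le he he').div_const _).ennreal_ofReal)
    (Eventually.of_forall fun x => ENNReal.ofReal_lt_top),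
    ← integral_foldDensity_mul hs.le he he' hφ hM, ← integral_div]
  congr 1 with x
  have := le_foldDensity hs.le he he' x
  rw [ENNReal.toReal_ofReal (div_nonneg (by linarith) hp.le), smul_eq_mul]
  ring

theorem isProbabilityMeasure_foldMeasure (hs : 2 < s) (he : 0 ≤ e) (he' : e < 1 / 2) :
    IsProbabilityMeasure (foldMeasure s e) := by
  have hp := foldFunctional_one_pos hs he he'
  have h := integral_foldMeasure hs he he' (φ := fun _ => 1) (M := 1) measurable_const (by simp)
  rw [div_self hp.ne', integral_const, smul_eq_mul, mul_one, measureReal_def,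
    ENNReal.toReal_eq_one_iff] at h
  exact ⟨h⟩

theorem foldMeasure_absolutelyContinuous (s e : ℝ) :
    foldMeasure s e ≪ volume.restrict (Ioc (0 : ℝ) (1 / 2)) :=
  withDensity_absolutelyContinuous _ _

theorem absolutelyContinuous_foldMeasure (hs : 2 < s) (he : 0 ≤ e) (he' : e < 1 / 2) :
    volume.restrict (Ioc (0 : ℝ) (1 / 2)) ≪ foldMeasure s e := by
  have hp := foldFunctional_one_pos hs he he'
  refine withDensity_absolutelyContinuous'
    (((measurable_foldDensity hs.le he he').div_const _).ennreal_ofReal).aemeasurable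
    (Eventually.of_forall fun x => ?_)
  have := le_foldDensity hs.le he he' x
  exact (ENNReal.ofReal_pos.2 (div_pos (by linarith) hp)).ne'

theorem measurePreserving_of_integral {T : ℝ → ℝ} {ρ : Measure ℝ} [IsProbabilityMeasure ρ]
    (hT : Measurable T) (h : ∀ φ : ℝ → ℝ, Measurable φ → (∀ x, |φ x| ≤ 1) →
      ∫ x, φ (T x) ∂ρ = ∫ x, φ x ∂ρ) : MeasurePreserving T ρ ρ := by
  refine ⟨hT, ?_⟩
  have := Measure.isProbabilityMeasure_map (μ := ρ) hT.aemeasurable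
  ext C hC
  rw [← measureReal_eq_measureReal_iff, measureReal_def, Measure.map_apply hT hC,
    ← measureReal_def]
  have h1 := h (C.indicator fun _ => 1) (measurable_const.indicator hC) (abs_indicator_one_le C)
  have h2 : (fun x => C.indicator (fun _ => (1 : ℝ)) (T x)) = (T ⁻¹' C).indicator fun _ => 1 := rfl
  rwa [h2, integral_indicator_const _ (hT hC), integral_indicator_const _ hC, smul_eq_mul,
    smul_eq_mul, mul_one, mul_one] at h1

theorem measurePreserving_foldMeasure (hs : 2 < s) (he : 0 ≤ e) (he' : e < 1 / 2) :
    MeasurePreserving (foldMap s e) (foldMeasure s e) (foldMeasure s e) := by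
  have := isProbabilityMeasure_foldMeasure hs he he'
  refine measurePreserving_of_integral continuous_foldMap.measurable fun φ hφ hM => ?_
  rw [integral_foldMeasure hs he he' hφ hM, ← foldFunctional_comp hs.le he he' hφ hM,
    integral_foldMeasure hs he he' (φ := fun x => φ (foldMap s e x)) (M := 1)
      (hφ.comp continuous_foldMap.measurable) fun x => hM _]

end orbit

/-! ### The case of peak height `1/2` -/

/-- The uniform distribution on `(0, 1/2]`. -/
noncomputable def halfUniform : Measure ℝ := (2 : ℝ≥0∞) • volume.restrict (Ioc (0 : ℝ) (1 / 2))

instance : IsProbabilityMeasure halfUniform := by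
  constructor
  rw [halfUniform, Measure.smul_apply, Measure.restrict_apply_univ, Real.volume_Ioc, sub_zero,
    smul_eq_mul, one_div, ENNReal.ofReal_inv_of_pos two_pos, ENNReal.ofReal_ofNat]
  exact ENNReal.mul_inv_cancel (by norm_num) (by norm_num)

theorem integral_halfUniform (φ : ℝ → ℝ) :
    ∫ x, φ x ∂halfUniform = 2 * ∫ y in (0 : ℝ)..(1 / 2), φ y := by
  rw [halfUniform, integral_smul_measure, intervalIntegral.integral_of_le (by norm_num)]
  simp

theorem measurePreserving_halfUniform {s : ℝ} (hs : 2 ≤ s) :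
    MeasurePreserving (foldMap s 0) halfUniform halfUniform := by
  refine measurePreserving_of_integral continuous_foldMap.measurable fun φ hφ hM => ?_
  rw [integral_halfUniform, integral_halfUniform,
    integral_half_comp_foldMap hs le_rfl (by norm_num) hφ hM]
  simp

/-! ### Passage between the `W`-shaped map and its fold -/

theorem volume_preimage_affine_eq_zero {c q : ℝ} (hc : c ≠ 0) {N : Set ℝ} (hN : volume N = 0) :
    volume ((fun y => c * y + q) ⁻¹' N) = 0 := by
  have : (fun y => c * y + q) ⁻¹' N = (fun y => c * y) ⁻¹' ((fun z => z + q) ⁻¹' N) := rfl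
  rw [this, Real.volume_preimage_mul_left hc, measure_preimage_add_right, hN, mul_zero]

section fold

variable {s e : ℝ}

theorem map_foldLift_absolutelyContinuous (hs : 2 ≤ s) (he : 0 ≤ e) (he' : e < 1 / 2)
    {ν : Measure ℝ} (hν : ν ≪ volume.restrict (Ioc (0 : ℝ) (1 / 2))) :
    ν.map (foldLift s e) ≪ volume.restrict (Icc (0 : ℝ) 1) := by
  have hk := outerSlope_gt_two hs he he'
  refine (hν.map continuous_foldLift.measurable).trans
    (Measure.AbsolutelyContinuous.mk fun N hN h0 => ?_)
  rw [Measure.restrict_apply hN] at h0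
  rw [Measure.map_apply continuous_foldLift.measurable hN,
    Measure.restrict_apply (continuous_foldLift.measurable hN)]
  refine measure_mono_null (t := (fun y => (-s) * y + (1 / 2 + e)) ⁻¹' (N ∩ Icc 0 1)
    ∪ (fun y => outerSlope s e * y + (1 - outerSlope s e * (1 / 2))) ⁻¹' (N ∩ Icc 0 1)) ?_
    (measure_union_null (volume_preimage_affine_eq_zero (by linarith) h0)
      (volume_preimage_affine_eq_zero (by linarith) h0))
  rintro y ⟨hy, hy'⟩
  have hm := foldLift_mem hs he he' (Ioc_subset_Icc_self hy')
  have : foldLift s e y ∈ N ∩ Icc 0 1 := ⟨hy, hm⟩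
  rcases le_total y (foldZero s e) with h | h
  · left
    rw [foldLift_of_le hs he he' h] at this
    simp only [mem_preimage]
    convert this using 1
    ring
  · right
    rw [foldLift_of_ge hs he he' h] at this
    simp only [mem_preimage]
    convert this using 1
    ring

/-- The outer branch alone is onto `[0, 1]`; its inverse serves for surjectivity and for pushing
forward the Lebesgue class. -/
theorem foldLift_section (hs : 2 ≤ s) (he : 0 ≤ e) (he' : e < 1 / 2) {y : ℝ}
    (hy : y ∈ Icc (0 : ℝ) 1) :
    1 / 2 - (1 - y) / outerSlope s e ∈ Ioc (0 : ℝ) (1 / 2) ∧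
      foldLift s e (1 / 2 - (1 - y) / outerSlope s e) = y := by
  have hk := outerSlope_gt_two hs he he'
  have hz := one_div_outerSlope (s := s) (e := e) hs he'
  have hb := foldZero_pos (e := e) hs he
  have h1 : (1 - y) / outerSlope s e ≤ 1 / outerSlope s e := by
    gcongr
    linarith [hy.1]
  have h2 : 0 ≤ (1 - y) / outerSlope s e := div_nonneg (by linarith [hy.2]) (by linarith)
  refine ⟨⟨by linarith, by linarith⟩, ?_⟩
  rw [foldLift_of_ge hs he he' (by linarith)]
  field_simp
  ring

theorem absolutelyContinuous_map_foldLift (hs : 2 ≤ s) (he : 0 ≤ e) (he' : e < 1 / 2)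
    {ν : Measure ℝ} (hν : volume.restrict (Ioc (0 : ℝ) (1 / 2)) ≪ ν) :
    volume.restrict (Icc (0 : ℝ) 1) ≪ ν.map (foldLift s e) := by
  have hk := outerSlope_gt_two hs he he'
  refine Measure.AbsolutelyContinuous.trans (Measure.AbsolutelyContinuous.mk fun N hN h0 => ?_)
    (hν.map continuous_foldLift.measurable)
  rw [Measure.map_apply continuous_foldLift.measurable hN,
    Measure.restrict_apply (continuous_foldLift.measurable hN)] at h0
  rw [Measure.restrict_apply hN]
  have hc : 1 / outerSlope s e ≠ 0 := by positivity
  refine measure_mono_null ?_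
    (volume_preimage_affine_eq_zero (q := 1 / 2 - 1 / outerSlope s e) hc h0)
  rintro y ⟨hy, hy'⟩
  have h := foldLift_section hs he he' hy'
  have h2 : 1 / outerSlope s e * y + (1 / 2 - 1 / outerSlope s e)
      = 1 / 2 - (1 - y) / outerSlope s e := by ring
  simp only [mem_preimage, mem_inter_iff, h2]
  exact ⟨by rw [h.2]; exact hy, h.1⟩

theorem measurable_abs_sub_half : Measurable fun x : ℝ => |x - 1 / 2| := by fun_prop

theorem map_abs_sub_half_absolutelyContinuous {μ : Measure ℝ}
    (hμ : μ ≪ volume.restrict (Icc (0 : ℝ) 1)) :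
    μ.map (fun x => |x - 1 / 2|) ≪ volume.restrict (Ioc (0 : ℝ) (1 / 2)) := by
  refine (hμ.map measurable_abs_sub_half).trans
    (Measure.AbsolutelyContinuous.mk fun N hN h0 => ?_)
  rw [Measure.restrict_apply hN] at h0
  rw [Measure.map_apply measurable_abs_sub_half hN,
    Measure.restrict_apply (measurable_abs_sub_half hN)]
  refine measure_mono_null (t := ((fun y => 1 * y + (-(1 / 2) : ℝ)) ⁻¹' (N ∩ Ioc 0 (1 / 2))
    ∪ (fun y => (-1) * y + (1 / 2 : ℝ)) ⁻¹' (N ∩ Ioc 0 (1 / 2))) ∪ {1 / 2}) ?_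
    (measure_union_null (measure_union_null (volume_preimage_affine_eq_zero (by norm_num) h0)
      (volume_preimage_affine_eq_zero (by norm_num) h0)) Real.volume_singleton)
  rintro x ⟨hx, hx'⟩
  have hm := abs_sub_half_mem hx'
  rcases lt_trichotomy x (1 / 2) with h | h | h
  · left; right
    have : |x - 1 / 2| ∈ N ∩ Ioc 0 (1 / 2) := ⟨hx, abs_pos.2 (by linarith), hm.2⟩
    rw [abs_of_neg (by linarith)] at this
    simp only [mem_preimage]
    convert this using 1
    ring
  · right; exact h
  · left; left
    have : |x - 1 / 2| ∈ N ∩ Ioc 0 (1 / 2) := ⟨hx, abs_pos.2 (by linarith), hm.2⟩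
    rw [abs_of_pos (by linarith)] at this
    simp only [mem_preimage]
    convert this using 1
    ring

/-- The symmetric `W`-shaped map with middle slope `s` and peak `1/2 + e`. -/
noncomputable def symmetricW (s e x : ℝ) : ℝ := foldLift s e |x - 1 / 2|

theorem measurable_symmetricW : Measurable (symmetricW s e) :=
  continuous_foldLift.measurable.comp measurable_abs_sub_half

/-- With `F` the fold and `L` the lift, `W = L ∘ F` and `T = F ∘ L`, so `T ∘ F = F ∘ W` holds by
definition. -/
theorem measurePreserving_abs_sub_half {μ : Measure ℝ}
    (h : MeasurePreserving (symmetricW s e) μ μ) :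
    MeasurePreserving (foldMap s e) (μ.map fun x => |x - 1 / 2|) (μ.map fun x => |x - 1 / 2|) := by
  refine ⟨continuous_foldMap.measurable, ?_⟩
  rw [Measure.map_map continuous_foldMap.measurable measurable_abs_sub_half]
  have : foldMap s e ∘ (fun x => |x - 1 / 2|) = (fun x => |x - 1 / 2|) ∘ symmetricW s e := rfl
  rw [this, ← Measure.map_map measurable_abs_sub_half h.measurable, h.map_eq]

/-- Since `W = L ∘ F`, an invariant measure is recovered from its image under the fold; this makes
uniqueness descend to `T`. -/
theorem eq_map_foldLift {μ : Measure ℝ} (h : MeasurePreserving (symmetricW s e) μ μ) :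
    μ = (μ.map fun x => |x - 1 / 2|).map (foldLift s e) := by
  rw [Measure.map_map continuous_foldLift.measurable measurable_abs_sub_half]
  exact h.map_eq.symm

theorem measurePreserving_symmetricW {ν : Measure ℝ} (h : MeasurePreserving (foldMap s e) ν ν) :
    MeasurePreserving (symmetricW s e) (ν.map (foldLift s e)) (ν.map (foldLift s e)) := by
  refine ⟨measurable_symmetricW, ?_⟩
  rw [Measure.map_map measurable_symmetricW continuous_foldLift.measurable]
  have : symmetricW s e ∘ foldLift s e = foldLift s e ∘ foldMap s e := rfl
  rw [this, ← Measure.map_map continuous_foldLift.measurable h.measurable, h.map_eq]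

theorem isAcim_map_foldLift (hs : 2 ≤ s) (he : 0 ≤ e) (he' : e < 1 / 2) {ν : Measure ℝ}
    [IsProbabilityMeasure ν] (hν : ν ≪ volume.restrict (Ioc (0 : ℝ) (1 / 2)))
    (h : MeasurePreserving (foldMap s e) ν ν) :
    IsAcim (symmetricW s e) ⟨ν.map (foldLift s e),
      Measure.isProbabilityMeasure_map continuous_foldLift.measurable.aemeasurable⟩ :=
  ⟨measurePreserving_symmetricW h, map_foldLift_absolutelyContinuous hs he he' hν⟩

theorem uniformlyMixes_foldMap (hs : 2 ≤ s) (he : 0 ≤ e) (he' : e < 1 / 2) (h : e = 0 ∨ 2 < s)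
    (u : ℝ) : UniformlyMixes (foldMap s e) ((Iic u).indicator fun _ => 1) :=
  UniformlyMixes.indicator_Iic hs he he' h u

theorem IsAcim.unique (hs : 2 ≤ s) (he : 0 ≤ e) (he' : e < 1 / 2) (h : e = 0 ∨ 2 < s)
    {μ₁ μ₂ : ProbabilityMeasure ℝ} (h₁ : IsAcim (symmetricW s e) μ₁)
    (h₂ : IsAcim (symmetricW s e) μ₂) : μ₁ = μ₂ := by
  have p₁ := Measure.isProbabilityMeasure_map (μ := (μ₁ : Measure ℝ))
    measurable_abs_sub_half.aemeasurable
  have p₂ := Measure.isProbabilityMeasure_map (μ := (μ₂ : Measure ℝ))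
    measurable_abs_sub_half.aemeasurable
  have := eq_of_measurePreserving (uniformlyMixes_foldMap hs he he' h)
    (map_abs_sub_half_absolutelyContinuous h₁.2) (map_abs_sub_half_absolutelyContinuous h₂.2)
    (measurePreserving_abs_sub_half h₁.1) (measurePreserving_abs_sub_half h₂.1)
  exact Subtype.ext ((eq_map_foldLift h₁.1).trans
    ((congrArg _ this).trans (eq_map_foldLift h₂.1).symm))

theorem iterate_symmetricW_succ (n : ℕ) (x : ℝ) :
    (symmetricW s e)^[n + 1] x = foldLift s e ((foldMap s e)^[n] |x - 1 / 2|) := by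
  induction n with
  | zero => rfl
  | succ n ih => rw [Function.iterate_succ_apply', ih, Function.iterate_succ_apply' (foldMap s e)]; rfl

/-- The case `n = 1` of the tail condition shows that `A` is essentially a preimage under the fold.
By `W^{n+1} = L ∘ T^n ∘ F`, the folded set inherits the tail condition for `T`. -/
theorem IsAcim.isExact (hs : 2 ≤ s) (he : 0 ≤ e) (he' : e < 1 / 2) (h : e = 0 ∨ 2 < s)
    {μ : ProbabilityMeasure ℝ} (hμ : IsAcim (symmetricW s e) μ) : IsExact (symmetricW s e) μ := by
  intro A hA hB
  have p := Measure.isProbabilityMeasure_map (μ := (μ : Measure ℝ))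
    measurable_abs_sub_half.aemeasurable
  obtain ⟨B₁, hB₁, hAB₁⟩ := hB 1
  have hC : MeasurableSet (foldLift s e ⁻¹' B₁) := continuous_foldLift.measurable hB₁
  have hAC : A =ᵐ[(μ : Measure ℝ)] (fun x => |x - 1 / 2|) ⁻¹' (foldLift s e ⁻¹' B₁) := hAB₁
  have key := measure_eq_zero_or_one_of_mixes (uniformlyMixes_foldMap hs he he' h)
    (map_abs_sub_half_absolutelyContinuous hμ.2) (measurePreserving_abs_sub_half hμ.1)
    (A := foldLift s e ⁻¹' B₁) fun n => by
      obtain ⟨B, hBm, hAB⟩ := hB (n + 1)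
      refine ⟨foldLift s e ⁻¹' B, continuous_foldLift.measurable hBm, ?_⟩
      have hD : MeasurableSet ((foldMap s e)^[n] ⁻¹' (foldLift s e ⁻¹' B)) :=
        continuous_foldMap.measurable.iterate n (continuous_foldLift.measurable hBm)
      have h1 : (fun x => |x - 1 / 2|) ⁻¹' (foldLift s e ⁻¹' B₁) =ᵐ[(μ : Measure ℝ)]
          (fun x => |x - 1 / 2|) ⁻¹' ((foldMap s e)^[n] ⁻¹' (foldLift s e ⁻¹' B)) := by
        refine hAC.symm.trans (hAB.trans (Eventually.of_forall fun x => ?_))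
        exact congrArg (fun z => z ∈ B) (iterate_symmetricW_succ n x)
      rw [ae_eq_set] at h1 ⊢
      rw [Measure.map_apply measurable_abs_sub_half (hC.diff hD),
        Measure.map_apply measurable_abs_sub_half (hD.diff hC)]
      exact h1
  rw [Measure.map_apply measurable_abs_sub_half hC, ← measure_congr hAC] at key
  exact key

/-- For `e = 0` the uniform measure is invariant under the fold, which covers `s = 2`, where the
lower bound `s - 2` on the density degenerates. -/
theorem exists_isAcim_symmetricW (hs : 2 ≤ s) (he : 0 ≤ e) (he' : e < 1 / 2) (h : e = 0 ∨ 2 < s) :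
    ∃ μ : ProbabilityMeasure ℝ, IsAcim (symmetricW s e) μ := by
  rcases h with rfl | h
  · exact ⟨_, isAcim_map_foldLift hs he he' (ν := halfUniform)
      Measure.smul_absolutelyContinuous (measurePreserving_halfUniform hs)⟩
  · have := isProbabilityMeasure_foldMeasure h he he'
    exact ⟨_, isAcim_map_foldLift hs he he' (foldMeasure_absolutelyContinuous s e)
      (measurePreserving_foldMeasure h he he')⟩

theorem IsAcim.eq_map_foldMeasure (hs : 2 < s) (he : 0 ≤ e) (he' : e < 1 / 2)
    {μ : ProbabilityMeasure ℝ} (hμ : IsAcim (symmetricW s e) μ) :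
    (μ : Measure ℝ) = (foldMeasure s e).map (foldLift s e) := by
  have := isProbabilityMeasure_foldMeasure hs he he'
  exact congrArg Subtype.val (hμ.unique hs.le he he' (Or.inr hs)
    (isAcim_map_foldLift hs.le he he' (foldMeasure_absolutelyContinuous s e)
      (measurePreserving_foldMeasure hs he he')))

theorem IsAcim.eq_map_halfUniform (hs : 2 ≤ s) {μ : ProbabilityMeasure ℝ}
    (hμ : IsAcim (symmetricW s 0) μ) : (μ : Measure ℝ) = halfUniform.map (foldLift s 0) :=
  congrArg Subtype.val (hμ.unique hs le_rfl (by norm_num) (Or.inl rfl)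
    (isAcim_map_foldLift hs le_rfl (by norm_num) (ν := halfUniform) Measure.smul_absolutelyContinuous
      (measurePreserving_halfUniform hs)))

theorem IsAcim.absolutelyContinuous (hs : 2 < s) (he : 0 ≤ e) (he' : e < 1 / 2)
    {μ : ProbabilityMeasure ℝ} (hμ : IsAcim (symmetricW s e) μ) :
    volume.restrict (Icc (0 : ℝ) 1) ≪ (μ : Measure ℝ) := by
  rw [hμ.eq_map_foldMeasure hs he he']
  exact absolutelyContinuous_map_foldLift hs.le he he' (absolutelyContinuous_foldMeasure hs he he')

theorem image_symmetricW (hs : 2 ≤ s) (he : 0 ≤ e) (he' : e < 1 / 2) :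
    symmetricW s e '' Icc 0 1 = Icc 0 1 := by
  refine Subset.antisymm ?_ fun y hy => ?_
  · rintro _ ⟨x, hx, rfl⟩
    exact foldLift_mem hs he he' (abs_sub_half_mem hx)
  · obtain ⟨h1, h2⟩ := foldLift_section hs he he' hy
    refine ⟨1 / 2 + (1 / 2 - (1 - y) / outerSlope s e), ⟨by linarith [h1.1], by linarith [h1.2]⟩, ?_⟩
    rw [symmetricW, add_sub_cancel_left, abs_of_pos h1.1, h2]

end fold

/-! ### Support, identification of the family, slopes -/

theorem support_volume_restrict_Icc :
    (volume.restrict (Icc (0 : ℝ) 1)).support = Icc 0 1 := by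
  refine Subset.antisymm (Measure.support_subset_of_isClosed isClosed_Icc
    (ae_restrict_mem measurableSet_Icc)) ?_
  calc Icc (0 : ℝ) 1 = closure (Ioo 0 1) := (closure_Ioo (zero_ne_one' ℝ)).symm
    _ ⊆ _ := Measure.isClosed_support.closure_subset_iff.2 fun x hx =>
      Measure.interior_inter_support ⟨by rwa [interior_Icc],
        by rw [Measure.support_eq_univ]; trivial⟩

theorem IsAcim.support_eq {T : ℝ → ℝ} {μ : ProbabilityMeasure ℝ} (hμ : IsAcim T μ)
    (h : volume.restrict (Icc (0 : ℝ) 1) ≪ (μ : Measure ℝ)) :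
    (μ : Measure ℝ).support = Icc 0 1 := by
  rw [← support_volume_restrict_Icc]
  exact Subset.antisymm hμ.2.support_mono h.support_mono

theorem wFamily_eq_symmetricW {r a : ℝ} (ha : 0 ≤ a) (hr : 0 ≤ r * a) (hra : r * a < 1 / 2) :
    wFamily r a = symmetricW (2 + a) (r * a) := by
  have hs : (2 : ℝ) ≤ 2 + a := by linarith
  have hz := foldZero_pos (s := 2 + a) (e := r * a) hs hr
  have hk : 2 * (2 + 1 * a) / (2 - 1 + 1 * a - 2 * r * a) = outerSlope (2 + a) (r * a) := by
    unfold outerSlope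
    congr 1 <;> ring
  have hf : (1 / 2 + r * a) / (2 + 1 * a) = foldZero (2 + a) (r * a) := by
    rw [foldZero, one_mul]
  funext x
  unfold wFamily wMap symmetricW
  rw [hk, hf]
  split_ifs with h1 h2 h3
  · rw [abs_of_neg (by linarith), foldLift_of_ge hs hr hra (by linarith)]
    ring
  · rw [abs_of_neg (by linarith), foldLift_of_le hs hr hra (by linarith)]
    ring
  · rw [abs_of_nonneg (by linarith), foldLift_of_le hs hr hra (by linarith)]
    ring
  · rw [abs_of_nonneg (by linarith), foldLift_of_ge hs hr hra (by linarith)]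
    ring

theorem wZero_eq_symmetricW : wZero = symmetricW 2 0 := by
  have := wFamily_eq_symmetricW (r := 1) (a := 0) le_rfl (by norm_num) (by norm_num)
  rw [add_zero, mul_zero] at this
  exact this

/-- At `0` and `1` a full neighbourhood is still available, because the outer branches extend
affinely beyond the interval. -/
theorem two_lt_abs_derivWithin_of_eventuallyEq {f : ℝ → ℝ} {x c q : ℝ} (hx : x ∈ Icc (0 : ℝ) 1)
    (hc : 2 < |c|) (h : f =ᶠ[𝓝 x] fun y => c * y + q) :
    2 < |derivWithin f (Icc 0 1) x| := by
  have h1 : HasDerivAt f c x :=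
    (by simpa using ((hasDerivAt_id x).const_mul c).add_const q :
      HasDerivAt (fun y => c * y + q) c x).congr_of_eventuallyEq h
  rwa [h1.hasDerivWithinAt.derivWithin (uniqueDiffOn_Icc zero_lt_one x hx)]

theorem two_lt_abs_derivWithin_wFamily {r a : ℝ} (ha : 0 < a) (hr : 0 ≤ r * a)
    (hra : r * a < 1 / 2) {x : ℝ} (hx : x ∈ Icc (0 : ℝ) 1 \ wBreaks r a) :
    2 < |derivWithin (wFamily r a) (Icc 0 1) x| := by
  have hs : (2 : ℝ) ≤ 2 + a := by linarith
  have hz := foldZero_pos (s := 2 + a) (e := r * a) hs hr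
  have hk := outerSlope_gt_two hs hr hra
  have hs' : 2 < |2 + a| := by rw [abs_of_pos (by linarith)]; linarith
  have hk' : 2 < |outerSlope (2 + a) (r * a)| := by rwa [abs_of_pos (by linarith)]
  rw [wFamily_eq_symmetricW ha.le hr hra]
  obtain ⟨hx, hxb⟩ := hx
  simp only [wBreaks, mem_insert_iff, mem_singleton_iff, not_or] at hxb
  obtain ⟨n1, n2, n3⟩ := hxb
  change x ≠ 1 / 2 - foldZero (2 + a) (r * a) at n1
  change x ≠ 1 / 2 + foldZero (2 + a) (r * a) at n3
  rcases lt_or_gt_of_ne n2 with h | h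
  · rcases lt_or_gt_of_ne n1 with h' | h'
    · refine two_lt_abs_derivWithin_of_eventuallyEq (c := -outerSlope (2 + a) (r * a)) (q := 1) hx
        (by rwa [abs_neg]) ?_
      filter_upwards [Iio_mem_nhds h'] with y hy
      rw [mem_Iio] at hy
      rw [symmetricW, abs_of_neg (by linarith), foldLift_of_ge hs hr hra (by linarith)]
      ring
    · refine two_lt_abs_derivWithin_of_eventuallyEq (c := 2 + a)
        (q := 1 / 2 + r * a - (2 + a) * (1 / 2)) hx hs' ?_
      filter_upwards [Ioo_mem_nhds h' h] with y hy
      rw [symmetricW, abs_of_neg (by linarith [hy.2]),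
        foldLift_of_le hs hr hra (by linarith [hy.1])]
      ring
  · rcases lt_or_gt_of_ne n3 with h' | h'
    · refine two_lt_abs_derivWithin_of_eventuallyEq (c := -(2 + a))
        (q := 1 / 2 + r * a + (2 + a) * (1 / 2)) hx (by rwa [abs_neg]) ?_
      filter_upwards [Ioo_mem_nhds h h'] with y hy
      rw [symmetricW, abs_of_pos (by linarith [hy.1]),
        foldLift_of_le hs hr hra (by linarith [hy.2])]
      ring
    · refine two_lt_abs_derivWithin_of_eventuallyEq (c := outerSlope (2 + a) (r * a))
        (q := 1 - outerSlope (2 + a) (r * a)) hx hk' ?_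
      filter_upwards [Ioi_mem_nhds h'] with y hy
      rw [mem_Ioi] at hy
      rw [symmetricW, abs_of_pos (by linarith), foldLift_of_ge hs hr hra (by linarith)]
      ring

/-! ### Asymptotics of the invariant density as `a → 0` -/

section asymptotics

variable {r a : ℝ}

/-- For `a ≤ 1` the outer slope is at least `s`, so all weights are dominated by powers of `1/s`. -/
theorem one_div_outerSlope_le (hr : 0 ≤ r) (ha : 0 < a) (ha1 : a ≤ 1) (hra : r * a < 1 / 2) :
    1 / outerSlope (2 + a) (r * a) ≤ 1 / (2 + a) := by
  refine one_div_le_one_div_of_le (by linarith) ?_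
  rw [outerSlope, le_div_iff₀ (by linarith)]
  nlinarith [mul_nonneg hr ha.le]

theorem abs_foldWeight_le_pow (hr : 0 ≤ r) (ha : 0 < a) (ha1 : a ≤ 1) (hra : r * a < 1 / 2)
    (n : ℕ) : |foldWeight (2 + a) (r * a) n| ≤ (1 / (2 + a)) ^ n :=
  abs_foldWeight_le (by linarith) (by positivity) hra le_rfl
    (one_div_outerSlope_le hr ha ha1 hra) n

/-- The critical orbit climbs the second branch until its weight is of order `a ^ 2`. -/
theorem foldOrbit_dichotomy (hr : 0 < r) (ha : 0 < a) (ha1 : a ≤ 1) (hra : r * a ≤ 1 / 12)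
    (n : ℕ) :
    (foldWeight (2 + a) (r * a) n = (1 / (2 + a)) ^ n ∧
      foldOrbit (2 + a) (r * a) n = r * a / (1 + a) * (1 + a * (2 + a) ^ n)) ∨
    (1 / (2 + a)) ^ n ≤ 12 * r * a ^ 2 := by
  have hs : (2 : ℝ) ≤ 2 + a := by linarith
  have he : 0 ≤ r * a := by positivity
  have he' : r * a < 1 / 2 := by linarith
  induction n with
  | zero =>
    left
    refine ⟨by simp [foldWeight], ?_⟩
    simp only [foldOrbit, Function.iterate_zero, id, pow_zero]
    field_simp
  | succ n ih =>
    have hstep : (1 / (2 + a)) ^ (n + 1) ≤ (1 / (2 + a)) ^ n :=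
      pow_le_pow_of_le_one (by positivity) (by rw [div_le_one (by linarith)]; linarith) (by lia)
    rcases ih with ⟨hw, ht⟩ | hbad
    · have hp : r * a / (1 + a) ≤ r * a := div_le_self he (by linarith)
      have hp0 : 0 < r * a / (1 + a) := by positivity
      by_cases hb : foldOrbit (2 + a) (r * a) n < foldZero (2 + a) (r * a)
      · left
        have h1 : r * a / (2 + a) ≤ foldOrbit (2 + a) (r * a) n := by
          rw [ht]
          calc r * a / (2 + a) ≤ r * a / (1 + a) := by gcongr; linarith
            _ ≤ _ := le_mul_of_one_le_right hp0.le (by linarith [show 0 ≤ a * (2 + a) ^ n by positivity])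
        constructor
        · rw [foldWeight, branchCoeff, if_neg h1.not_gt, if_pos hb, hw, pow_succ]
        · rw [foldOrbit_succ, foldMap_branch_two hs he he' h1 hb.le, ht]
          field_simp
          ring
      · right
        refine hstep.trans ?_
        push Not at hb
        have h6 : 1 / 6 ≤ foldZero (2 + a) (r * a) := by
          rw [foldZero, le_div_iff₀ (by linarith)]
          linarith
        rw [ht] at hb
        -- The orbit has reached `foldZero ≥ 1/6` and `p ≤ 1/12`, so `p a s^n ≥ 1/12` with `p ≤ r
        -- a`.
        have h12 : 1 ≤ 12 * r * a ^ 2 * (2 + a) ^ n := by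
          have : r * a / (1 + a) * (a * (2 + a) ^ n) ≤ r * a * (a * (2 + a) ^ n) := by gcongr
          linarith
        rw [one_div, inv_pow, inv_le_iff_one_le_mul₀ (by positivity)]
        exact h12
    · exact Or.inr (hstep.trans hbad)

theorem sqrt_half_pow_sq (n : ℕ) : (√(1 / 2 : ℝ) ^ n) ^ 2 = (1 / 2) ^ n := by
  rw [← pow_mul, mul_comm, pow_mul, Real.sq_sqrt (by norm_num)]

theorem sqrt_half_lt_one : √(1 / 2 : ℝ) < 1 := by
  rw [Real.sqrt_lt' one_pos]; norm_num

theorem half_pow_le (n : ℕ) : (1 / 2 : ℝ) ^ n ≤ √(1 / 2) ^ n := by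
  gcongr
  exact Real.le_sqrt_of_sq_le (by norm_num)

/-- A quantity that is both `O(a^2)` and `O(2^{-n})` is bounded by the geometric mean, which is
linear in `a` and summable in `n`: the domination needed after division by `a`. The constant uses
`√c ≤ 1 + c`. -/
theorem le_of_sq_le_half_pow {x c : ℝ} (hc : 0 ≤ c) (ha : 0 < a) (n : ℕ)
    (h : x ^ 2 ≤ c * a ^ 2 * (1 / 2) ^ n) : x ≤ (1 + c) * a * √(1 / 2) ^ n := by
  refine le_of_sq_le_sq ?_ (by positivity)
  rw [mul_pow, sqrt_half_pow_sq]
  refine h.trans ?_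
  gcongr
  rw [mul_pow]
  gcongr
  nlinarith

theorem one_div_pow_le_half_pow (ha : 0 < a) (n : ℕ) : (1 / (2 + a)) ^ n ≤ (1 / 2) ^ n := by
  gcongr
  linarith

theorem one_div_pow_le_of_le (hr : 0 < r) (ha : 0 < a) {n : ℕ}
    (h : (1 / (2 + a)) ^ n ≤ 12 * r * a ^ 2) :
    (1 / (2 + a)) ^ n ≤ (1 + 12 * r) * a * √(1 / 2) ^ n := by
  refine le_of_sq_le_half_pow (by positivity) ha n ?_
  rw [pow_two]
  have := one_div_pow_le_half_pow ha n
  gcongr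

theorem abs_foldWeight_sub_le (hr : 0 < r) (ha : 0 < a) (ha1 : a ≤ 1) (hra : r * a ≤ 1 / 12)
    (n : ℕ) :
    |(1 / (2 + a)) ^ n - foldWeight (2 + a) (r * a) n| ≤ 2 * (1 + 12 * r) * a * √(1 / 2) ^ n := by
  rcases foldOrbit_dichotomy hr ha ha1 hra n with ⟨hw, _⟩ | h
  · rw [hw, sub_self, abs_zero]
    positivity
  · have h1 := abs_foldWeight_le_pow hr.le ha ha1 (by linarith) n
    have h2 := one_div_pow_le_of_le hr ha h
    have h3 : 0 ≤ (1 / (2 + a)) ^ n := by positivity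
    rw [abs_le] at *
    constructor <;> linarith

theorem abs_foldWeight_mul_foldOrbit_le (hr : 0 < r) (ha : 0 < a) (ha1 : a ≤ 1)
    (hra : r * a ≤ 1 / 12) (n : ℕ) :
    |foldWeight (2 + a) (r * a) n| * foldOrbit (2 + a) (r * a) n
      ≤ 2 * (1 + 12 * r) * a * √(1 / 2) ^ n := by
  have hs : (2 : ℝ) ≤ 2 + a := by linarith
  have he : 0 ≤ r * a := by positivity
  have he' : r * a < 1 / 2 := by linarith
  have hm := foldOrbit_mem hs he he' n
  have hW := half_pow_le n
  have hW0 : 0 ≤ √(1 / 2 : ℝ) ^ n := by positivity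
  rcases foldOrbit_dichotomy hr ha ha1 hra n with ⟨hw, ht⟩ | h
  · have hp : r * a / (1 + a) ≤ r * a := div_le_self he (by linarith)
    have hp0 : 0 < r * a / (1 + a) := by positivity
    set p := r * a / (1 + a) with hpdef
    have hmul : (1 / (2 + a)) ^ n * (2 + a) ^ n = 1 := by
      rw [← mul_pow, one_div_mul_cancel (by linarith), one_pow]
    have heq : |foldWeight (2 + a) (r * a) n| * foldOrbit (2 + a) (r * a) n
        = (1 / (2 + a)) ^ n * p + p * a := by
      rw [hw, ht, abs_of_pos (by positivity)]
      linear_combination (p * a) * hmul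
    have b1 : (1 / (2 + a)) ^ n * p ≤ r * a * √(1 / 2) ^ n := by
      have := (one_div_pow_le_half_pow ha n).trans hW
      calc _ ≤ √(1 / 2) ^ n * (r * a) := by gcongr
        _ = _ := mul_comm _ _
    -- Two bounds enter the geometric mean: `p a ≤ r a^2`, and `p a s^n ≤ t_n ≤ 1/2`, which gives `p
    -- a ≤ 2^{-n}`.
    have b2 : p * a ≤ (1 + r) * a * √(1 / 2) ^ n := by
      refine le_of_sq_le_half_pow hr.le ha n ?_
      have c1 : p * a ≤ (1 / 2) ^ n := by
        have h2 := hm.2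
        rw [ht] at h2
        calc p * a = (1 / (2 + a)) ^ n * (p * (a * (2 + a) ^ n)) := by
              linear_combination (-p * a) * hmul
          _ ≤ (1 / (2 + a)) ^ n * 1 := by gcongr; linarith
          _ ≤ _ := by rw [mul_one]; exact one_div_pow_le_half_pow ha n
      have c2 : p * a ≤ r * a ^ 2 := by nlinarith
      rw [pow_two]
      exact mul_le_mul c2 c1 (by positivity) (by positivity)
    rw [heq]
    have : 0 ≤ r * a * √(1 / 2) ^ n := by positivity
    have : 0 ≤ a * √(1 / 2) ^ n := by positivity
    nlinarith
  · have h1 := abs_foldWeight_le_pow hr.le ha ha1 (by linarith) n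
    have h2 := one_div_pow_le_of_le hr ha h
    calc _ ≤ (1 / (2 + a)) ^ n * (1 / 2) := mul_le_mul h1 hm.2 hm.1 (by positivity)
      _ ≤ _ := by
        have : 0 ≤ (1 / (2 + a)) ^ n := by positivity
        have : 0 ≤ (1 + 12 * r) * a * √(1 / 2) ^ n := by positivity
        linarith

theorem eventually_small (hr : 0 < r) :
    ∀ᶠ a in 𝓝[>] (0 : ℝ), 0 < a ∧ a ≤ 1 ∧ r * a ≤ 1 / 12 := by
  have h : (0 : ℝ) < min 1 (1 / (12 * r)) := by positivity
  filter_upwards [Ioo_mem_nhdsGT h] with a ha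
  have h1 := ha.2.le.trans (min_le_left _ _)
  have h2 := ha.2.le.trans (min_le_right _ _)
  refine ⟨ha.1, h1, ?_⟩
  rw [le_div_iff₀ (by positivity)] at h2 ⊢
  linarith

/-- For fixed `n`, `s^{-n} ≥ 3^{-n}` eventually exceeds `12 r a^2`, which excludes the second
alternative of the dichotomy. -/
theorem eventually_foldOrbit_eq (hr : 0 < r) (n : ℕ) :
    ∀ᶠ a in 𝓝[>] (0 : ℝ), foldWeight (2 + a) (r * a) n = (1 / (2 + a)) ^ n ∧
      foldOrbit (2 + a) (r * a) n = r * a / (1 + a) * (1 + a * (2 + a) ^ n) := by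
  have h : Tendsto (fun a : ℝ => 12 * r * a ^ 2) (𝓝[>] 0) (𝓝 0) := by
    have : Continuous fun a : ℝ => 12 * r * a ^ 2 := by fun_prop
    simpa using (this.tendsto 0).mono_left nhdsWithin_le_nhds
  filter_upwards [eventually_small hr,
    h.eventually (gt_mem_nhds (show (0 : ℝ) < (1 / 3) ^ n by positivity))] with a ⟨h0, h1, h2⟩ h3
  refine (foldOrbit_dichotomy hr h0 h1 h2 n).resolve_right fun hb => ?_
  have : (1 / 3 : ℝ) ^ n ≤ (1 / (2 + a)) ^ n := by
    gcongr
    linarith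
  linarith

/-- With the weights `s^{-n}` the constant would be `s - s/(s-1) = a (2+a)/(1+a)`; the corrections
vanish after division by `a` by dominated convergence. -/
theorem tendsto_foldConst_div (hr : 0 < r) :
    Tendsto (fun a => foldConst (2 + a) (r * a) / a) (𝓝[>] 0) (𝓝 2) := by
  have h1 : Tendsto (fun a => ∑' n, ((1 / (2 + a)) ^ n - foldWeight (2 + a) (r * a) n) / a)
      (𝓝[>] 0) (𝓝 (∑' _ : ℕ, 0)) := by
    refine tendsto_tsum_of_dominated_convergence
      ((summable_geometric_of_lt_one (Real.sqrt_nonneg _) sqrt_half_lt_one).mul_left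
        (2 * (1 + 12 * r))) (fun n => ?_) ?_
    · refine tendsto_const_nhds.congr' ?_
      filter_upwards [eventually_foldOrbit_eq hr n] with a ha
      rw [ha.1, sub_self, zero_div]
    · filter_upwards [eventually_small hr] with a ⟨h0, h1, h2⟩ n
      rw [Real.norm_eq_abs, abs_div, abs_of_pos h0, div_le_iff₀ h0]
      have := abs_foldWeight_sub_le hr h0 h1 h2 n
      linarith
  have h2 : Tendsto (fun a : ℝ => (2 + a) / (1 + a)) (𝓝[>] 0) (𝓝 2) := by
    have : ContinuousAt (fun a : ℝ => (2 + a) / (1 + a)) 0 := by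
      refine ContinuousAt.div (by fun_prop) (by fun_prop) (by norm_num)
    simpa [ContinuousAt] using this.tendsto.mono_left nhdsWithin_le_nhds
  have h3 := h2.add h1
  rw [tsum_zero, add_zero] at h3
  refine h3.congr' ?_
  filter_upwards [eventually_small hr] with a ⟨h0, h1, h2⟩
  have hlt : 1 / (2 + a) < 1 := by rw [div_lt_one (by linarith)]; linarith
  have s1 := summable_geometric_of_lt_one (by positivity : 0 ≤ 1 / (2 + a)) hlt
  have s2 : Summable fun n => foldWeight (2 + a) (r * a) n := by
    simpa using summable_foldWeight_mul (x := fun _ => 1) (M := 1) (s := 2 + a) (e := r * a)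
      (by linarith) (by positivity) (by linarith) (by simp)
  rw [tsum_div_const, s1.tsum_sub s2, tsum_geometric_of_lt_one (by positivity) hlt, foldConst]
  have : 1 - 1 / (2 + a) = (1 + a) / (2 + a) := by field_simp; ring
  rw [this]
  field_simp
  ring

variable {ψ : ℝ → ℝ} {M : ℝ} {K : NNReal}

theorem abs_integral_foldLift_sub_le {s e t : ℝ} (hs : 2 ≤ s) (he : 0 ≤ e) (he' : e < 1 / 2)
    (hM : ∀ x, |ψ x| ≤ M) (hψ : LipschitzWith K ψ) (ht : 0 ≤ t) (ht' : t ≤ foldZero s e) :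
    |(∫ y in (0 : ℝ)..t, ψ (foldLift s e y)) - t * ψ (1 / 2)| ≤ K * (e + s * t) * t := by
  have hm : Measurable fun y => ψ (foldLift s e y) :=
    hψ.continuous.measurable.comp continuous_foldLift.measurable
  have h1 : t * ψ (1 / 2) = ∫ _ in (0 : ℝ)..t, ψ (1 / 2) := by simp
  rw [h1, ← intervalIntegral.integral_sub (intervalIntegrable_of_bounded hm (fun x => hM _) _ _)
    intervalIntegrable_const]
  have := intervalIntegral.norm_integral_le_of_norm_le_const (a := 0) (b := t)
    (C := K * (e + s * t)) (f := fun y => ψ (foldLift s e y) - ψ (1 / 2)) fun y hy => by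
      rw [uIoc_of_le ht] at hy
      rw [← dist_eq_norm]
      refine (hψ.dist_le_mul _ _).trans ?_
      gcongr
      rw [foldLift_of_le hs he he' (hy.2.trans ht'), Real.dist_eq, abs_le]
      have : s * y ≤ s * t := by gcongr; exact hy.2
      have : 0 ≤ s * y := mul_nonneg (by linarith) hy.1.le
      constructor <;> linarith
  rwa [sub_zero, abs_of_nonneg ht] at this

/-- For fixed `n` the orbit point is `a τ(a)` with `τ(a) → r`, and on `[0, t_n]` the lift stays
within `O(a)` of `1/2`. The contribution is therefore `w_n t_n ψ(1/2)` up to `O(a^2)`. -/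
theorem tendsto_foldWeight_mul_integral_div (hr : 0 < r) (hM : ∀ x, |ψ x| ≤ M)
    (hψ : LipschitzWith K ψ) (n : ℕ) :
    Tendsto (fun a => foldWeight (2 + a) (r * a) n
      * (∫ y in (0 : ℝ)..foldOrbit (2 + a) (r * a) n, ψ (foldLift (2 + a) (r * a) y)) / a)
      (𝓝[>] 0) (𝓝 ((1 / 2) ^ n * (r * ψ (1 / 2)))) := by
  set τ : ℝ → ℝ := fun a => r / (1 + a) * (1 + a * (2 + a) ^ n) with hτ
  have cτ : ContinuousAt τ 0 :=
    (ContinuousAt.div (by fun_prop) (by fun_prop) (by norm_num)).mul (by fun_prop)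
  have cw : ContinuousAt (fun a : ℝ => (1 / (2 + a)) ^ n) 0 :=
    (ContinuousAt.div (by fun_prop) (by fun_prop) (by norm_num)).pow n
  have h1 : Tendsto (fun a => (1 / (2 + a)) ^ n * (τ a * ψ (1 / 2))) (𝓝[>] 0)
      (𝓝 ((1 / 2) ^ n * (r * ψ (1 / 2)))) := by
    have c : ContinuousAt (fun a => (1 / (2 + a)) ^ n * (τ a * ψ (1 / 2))) 0 :=
      cw.mul (cτ.mul continuousAt_const)
    simpa [hτ] using c.tendsto.mono_left nhdsWithin_le_nhds
  have h2 : Tendsto (fun a => (1 / (2 + a)) ^ n * (K * (r * a + (2 + a) * (a * τ a)) * τ a))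
      (𝓝[>] 0) (𝓝 0) := by
    have c : ContinuousAt
        (fun a => (1 / (2 + a)) ^ n * (K * (r * a + (2 + a) * (a * τ a)) * τ a)) 0 :=
      cw.mul ((continuousAt_const.mul (ContinuousAt.add (by fun_prop)
        (ContinuousAt.mul (by fun_prop) (continuousAt_id.mul cτ)))).mul cτ)
    simpa using c.tendsto.mono_left nhdsWithin_le_nhds
  have h3 : ∀ᶠ a in 𝓝[>] (0 : ℝ), a * τ a ≤ 1 / 6 := by
    have c : ContinuousAt (fun a => a * τ a) 0 := continuousAt_id.mul cτ
    have c' : Tendsto (fun a => a * τ a) (𝓝[>] 0) (𝓝 0) := by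
      simpa using c.tendsto.mono_left nhdsWithin_le_nhds
    exact c'.eventually (ge_mem_nhds (by norm_num))
  have h4 := squeeze_zero_norm' (f := fun a => foldWeight (2 + a) (r * a) n
      * (∫ y in (0 : ℝ)..foldOrbit (2 + a) (r * a) n, ψ (foldLift (2 + a) (r * a) y)) / a
      - (1 / (2 + a)) ^ n * (τ a * ψ (1 / 2))) (t₀ := 𝓝[>] (0 : ℝ)) ?_ h2
  · simpa using h4.add h1
  filter_upwards [h3, eventually_small hr, eventually_foldOrbit_eq hr n] with a g3 ⟨g0, g1, g2⟩ g4
  have ht : foldOrbit (2 + a) (r * a) n = a * τ a := by rw [g4.2]; simp only [hτ]; ring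
  have hτ0 : 0 ≤ τ a := by simp only [hτ]; positivity
  have h6 : 1 / 6 ≤ foldZero (2 + a) (r * a) := by
    rw [foldZero, le_div_iff₀ (by linarith)]
    nlinarith [mul_pos hr g0]
  have key := abs_integral_foldLift_sub_le (s := 2 + a) (e := r * a) (t := a * τ a) (by linarith)
    (by positivity) (by linarith) hM hψ (by positivity) (g3.trans h6)
  rw [g4.1, ht]
  set I := ∫ y in (0 : ℝ)..a * τ a, ψ (foldLift (2 + a) (r * a) y)
  have : (1 / (2 + a)) ^ n * I / a - (1 / (2 + a)) ^ n * (τ a * ψ (1 / 2))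
      = (1 / (2 + a)) ^ n * ((I - a * τ a * ψ (1 / 2)) / a) := by field_simp
  rw [this, Real.norm_eq_abs, abs_mul, abs_of_nonneg (by positivity : 0 ≤ (1 / (2 + a)) ^ n),
    abs_div, abs_of_pos g0]
  gcongr
  rw [div_le_iff₀ g0]
  linarith

theorem continuousAt_foldLift_param (r y : ℝ) :
    ContinuousAt (fun a => foldLift (2 + a) (r * a) y) 0 := by
  have hz : ContinuousAt (fun a => foldZero (2 + a) (r * a)) 0 :=
    ContinuousAt.div (by fun_prop) (by fun_prop) (by norm_num)
  have hk : ContinuousAt (fun a => outerSlope (2 + a) (r * a)) 0 :=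
    ContinuousAt.div (by fun_prop) (by fun_prop) (by norm_num)
  unfold foldLift
  exact Tendsto.max (ContinuousAt.mul (by fun_prop) (hz.sub continuousAt_const))
    (hk.mul (continuousAt_const.sub hz))

theorem tendsto_integral_foldLift (r : ℝ) (hM : ∀ x, |ψ x| ≤ M) (hψ : Continuous ψ) :
    Tendsto (fun a => ∫ y in (0 : ℝ)..(1 / 2), ψ (foldLift (2 + a) (r * a) y)) (𝓝[>] 0)
      (𝓝 (∫ y in (0 : ℝ)..(1 / 2), ψ (foldLift 2 0 y))) := by
  refine intervalIntegral.tendsto_integral_filter_of_dominated_convergence (fun _ => M)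
    (Eventually.of_forall fun a => (hψ.comp continuous_foldLift).aestronglyMeasurable)
    (Eventually.of_forall fun a => Eventually.of_forall fun x _ => hM _)
    intervalIntegrable_const (Eventually.of_forall fun y _ => ?_)
  have := (hψ.continuousAt.comp (continuousAt_foldLift_param r y)).tendsto.mono_left
    (nhdsWithin_le_nhds (s := Ioi (0 : ℝ)))
  simpa [Function.comp_def] using this

theorem tendsto_foldFunctional_div (hr : 0 < r) (hM : ∀ x, |ψ x| ≤ M) (hψ : LipschitzWith K ψ) :
    Tendsto (fun a => foldFunctional (2 + a) (r * a) (fun y => ψ (foldLift (2 + a) (r * a) y)) / a)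
      (𝓝[>] 0) (𝓝 (2 * (∫ y in (0 : ℝ)..(1 / 2), ψ (foldLift 2 0 y)) + 2 * r * ψ (1 / 2))) := by
  have h0 : 0 ≤ M := (abs_nonneg _).trans (hM 0)
  have h1 := (tendsto_foldConst_div hr).mul (tendsto_integral_foldLift r hM hψ.continuous)
  have h2 : Tendsto (fun a => ∑' n, foldWeight (2 + a) (r * a) n
      * (∫ y in (0 : ℝ)..foldOrbit (2 + a) (r * a) n, ψ (foldLift (2 + a) (r * a) y)) / a)
      (𝓝[>] 0) (𝓝 (∑' n : ℕ, (1 / 2) ^ n * (r * ψ (1 / 2)))) := by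
    refine tendsto_tsum_of_dominated_convergence
      ((summable_geometric_of_lt_one (Real.sqrt_nonneg _) sqrt_half_lt_one).mul_left
        (M * (2 * (1 + 12 * r)))) (tendsto_foldWeight_mul_integral_div hr hM hψ) ?_
    filter_upwards [eventually_small hr] with a ⟨g0, g1, g2⟩ n
    have hm := foldOrbit_mem (s := 2 + a) (e := r * a) (by linarith) (by positivity)
      (by linarith) n
    have hb := intervalIntegral.norm_integral_le_of_norm_le_const (a := 0)
      (b := foldOrbit (2 + a) (r * a) n) (C := M)
      (f := fun y => ψ (foldLift (2 + a) (r * a) y)) fun y _ => hM _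
    rw [sub_zero, abs_of_nonneg hm.1, Real.norm_eq_abs] at hb
    have hw := abs_foldWeight_mul_foldOrbit_le hr g0 g1 g2 n
    rw [Real.norm_eq_abs, abs_div, abs_mul, abs_of_pos g0, div_le_iff₀ g0]
    calc _ ≤ |foldWeight (2 + a) (r * a) n| * (M * foldOrbit (2 + a) (r * a) n) := by gcongr
      _ = M * (|foldWeight (2 + a) (r * a) n| * foldOrbit (2 + a) (r * a) n) := by ring
      _ ≤ M * (2 * (1 + 12 * r) * a * √(1 / 2) ^ n) := by gcongr
      _ = _ := by ring
  have h3 := h1.add h2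
  rw [tsum_mul_right, tsum_geometric_two, ← mul_assoc 2 r] at h3
  refine h3.congr fun a => ?_
  rw [tsum_div_const, foldFunctional]
  ring

/-- Weak convergence is tested on bounded Lipschitz functions. Numerator and normalisation are both
of order `a`, so the factor `a` cancels in the quotient. -/
theorem tendsto_acim (hr : 0 < r) {μ : ℝ → ProbabilityMeasure ℝ} {μ₀ : ProbabilityMeasure ℝ}
    (hμ : ∀ a : ℝ, 0 < a → r * a < 1 / 2 → IsAcim (wFamily r a) (μ a)) (hμ₀ : IsAcim wZero μ₀) :
    Tendsto μ (𝓝[>] 0) (𝓝 (limitMeasure μ₀ r hr.le)) := by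
  rw [tendsto_iff_forall_lipschitz_integral_tendsto]
  rintro ψ ⟨D, hD⟩ ⟨K, hψ⟩
  have hM : ∀ x, |ψ x| ≤ |ψ 0| + D := fun x => by
    have := hD x 0
    rw [Real.dist_eq] at this
    calc |ψ x| = |ψ 0 + (ψ x - ψ 0)| := by ring_nf
      _ ≤ _ := (abs_add_le _ _).trans (by linarith)
  have t1 := tendsto_foldFunctional_div hr hM hψ
  have t2 := tendsto_foldFunctional_div (ψ := fun _ => 1) (M := 1) (K := 0) hr (by simp)
    (LipschitzWith.const 1)
  have hden : 2 * (∫ y in (0 : ℝ)..(1 / 2), (1 : ℝ)) + 2 * r * 1 = 1 + 2 * r := by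
    rw [intervalIntegral.integral_const]; norm_num
  rw [hden] at t2
  have t3 := t1.div t2 (by positivity)
  have hlim : ∫ x, ψ x ∂(limitMeasure μ₀ r hr.le : Measure ℝ)
      = (2 * (∫ y in (0 : ℝ)..(1 / 2), ψ (foldLift 2 0 y)) + 2 * r * ψ (1 / 2)) / (1 + 2 * r) := by
    rw [wZero_eq_symmetricW] at hμ₀
    have hi : ∀ (ρ : Measure ℝ) [IsProbabilityMeasure ρ], Integrable ψ ρ := fun ρ _ =>
      (integrable_const (|ψ 0| + D)).mono' hψ.continuous.aestronglyMeasurable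
        (Eventually.of_forall hM)
    have h0 : ∫ x, ψ x ∂(μ₀ : Measure ℝ) = 2 * ∫ y in (0 : ℝ)..(1 / 2), ψ (foldLift 2 0 y) := by
      rw [hμ₀.eq_map_halfUniform le_rfl, integral_map continuous_foldLift.measurable.aemeasurable
        hψ.continuous.aestronglyMeasurable, integral_halfUniform]
    change ∫ x, ψ x ∂(ENNReal.ofReal (1 / (1 + 2 * r)) • (μ₀ : Measure ℝ) +
      ENNReal.ofReal (2 * r / (1 + 2 * r)) • Measure.dirac (1 / 2)) = _
    rw [integral_add_measure ((hi _).smul_measure ENNReal.ofReal_ne_top)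
      ((hi _).smul_measure ENNReal.ofReal_ne_top), integral_smul_measure, integral_smul_measure,
      integral_dirac, h0, ENNReal.toReal_ofReal (by positivity),
      ENNReal.toReal_ofReal (by positivity), smul_eq_mul, smul_eq_mul]
    ring
  rw [hlim]
  refine t3.congr' ?_
  filter_upwards [eventually_small hr] with a ⟨g0, g1, g2⟩
  have he : 0 ≤ r * a := by positivity
  have he' : r * a < 1 / 2 := by linarith
  have h := hμ a g0 he'
  rw [wFamily_eq_symmetricW g0.le he he'] at h
  rw [h.eq_map_foldMeasure (by linarith) he he',
    integral_map continuous_foldLift.measurable.aemeasurable hψ.continuous.aestronglyMeasurable,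
    integral_foldMeasure (φ := fun x => ψ (foldLift (2 + a) (r * a) x)) (by linarith) he he'
      (hψ.continuous.measurable.comp continuous_foldLift.measurable) fun x => hM _]
  exact div_div_div_cancel_right₀ g0.ne' _ _

end asymptotics

/-! ### The diagonal sequence -/

theorem tendsto_limitMeasure (μ₀ : ProbabilityMeasure ℝ) :
    Tendsto (fun n : ℕ => limitMeasure μ₀ n n.cast_nonneg) atTop (𝓝 diracHalf) := by
  rw [ProbabilityMeasure.tendsto_iff_forall_integral_tendsto]
  intro f
  have h : ∀ n : ℕ, ∫ x, f x ∂(limitMeasure μ₀ n n.cast_nonneg : Measure ℝ)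
      = f (1 / 2) + (1 / (1 + 2 * (n : ℝ))) * ((∫ x, f x ∂(μ₀ : Measure ℝ)) - f (1 / 2)) := by
    intro n
    change ∫ x, f x ∂(ENNReal.ofReal (1 / (1 + 2 * (n : ℝ))) • (μ₀ : Measure ℝ) +
      ENNReal.ofReal (2 * (n : ℝ) / (1 + 2 * (n : ℝ))) • Measure.dirac (1 / 2)) = _
    rw [integral_add_measure ((f.integrable _).smul_measure ENNReal.ofReal_ne_top)
      ((f.integrable _).smul_measure ENNReal.ofReal_ne_top), integral_smul_measure,
      integral_smul_measure, integral_dirac, ENNReal.toReal_ofReal (by positivity),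
      ENNReal.toReal_ofReal (by positivity), smul_eq_mul, smul_eq_mul]
    field_simp
    ring
  have h2 : ∫ x, f x ∂(diracHalf : Measure ℝ) = f (1 / 2) := integral_dirac _ _
  simp only [h, h2]
  have h3 : Tendsto (fun n : ℕ => 1 / (1 + 2 * (n : ℝ))) atTop (𝓝 0) := by
    refine tendsto_const_nhds.div_atTop (tendsto_atTop_add_const_left _ _ ?_)
    exact tendsto_natCast_atTop_atTop.const_mul_atTop two_pos
  simpa using (h3.mul_const ((∫ x, f x ∂(μ₀ : Measure ℝ)) - f (1 / 2))).const_add (f (1 / 2))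

theorem IsWeakMetric.tendsto_of_lt {d : ProbabilityMeasure ℝ → ProbabilityMeasure ℝ → ℝ}
    (hd : IsWeakMetric d) {μ ν : ℕ → ProbabilityMeasure ℝ} {ρ : ProbabilityMeasure ℝ}
    (hν : Tendsto ν atTop (𝓝 ρ)) (h : ∀ n : ℕ, 1 ≤ n → d (μ n) (ν n) < 1 / n) :
    Tendsto μ atTop (𝓝 ρ) := by
  rw [(hd.nhds_basis ρ).tendsto_right_iff] at hν ⊢
  intro ε hε
  have h1 : ∀ᶠ n : ℕ in atTop, (1 : ℝ) / n < ε / 2 :=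
    tendsto_one_div_atTop_nhds_zero_nat.eventually (gt_mem_nhds (by positivity))
  filter_upwards [hν (ε / 2) (by positivity), h1, eventually_ge_atTop 1] with n h2 h3 h4
  have h5 := h n h4
  have h6 := hd.triangle (μ n) (ν n) ρ
  change d (ν n) ρ < ε / 2 at h2
  change d (μ n) ρ < ε
  linarith

theorem tendsto_measure_of_tendsto_diracHalf {μ : ℕ → ProbabilityMeasure ℝ}
    (h : Tendsto μ atTop (𝓝 diracHalf)) {E : Set ℝ} (hE : (1 / 2 : ℝ) ∉ frontier E) :
    Tendsto (fun n => (μ n : Measure ℝ) E) atTop (𝓝 (Measure.dirac (1 / 2 : ℝ) E)) := by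
  refine ProbabilityMeasure.tendsto_measure_of_null_frontier_of_tendsto' h ?_
  change Measure.dirac (1 / 2 : ℝ) (frontier E) = 0
  rw [Measure.dirac_apply' _ isClosed_frontier.measurableSet, indicator_of_notMem hE]

/-- An invariant measure concentrated near `1/2` forces the peak of the map to be near `1/2`. -/
theorem peak_le_of_half_lt {s e δ : ℝ} (hs : 2 ≤ s) {μ : Measure ℝ} [IsProbabilityMeasure μ]
    (h : MeasurePreserving (symmetricW s e) μ μ) (hμ : 1 / 2 < μ (Metric.ball (1 / 2) δ)) :
    e ≤ (s + 1) * δ := by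
  by_contra! hlt
  -- On the ball, `W ≥ 1/2 + e - sδ > 1/2 + δ`, so the ball and its preimage are disjoint; by
  -- invariance both have measure above `1/2`, which is absurd.
  have hdisj : Disjoint (Metric.ball (1 / 2) δ) (symmetricW s e ⁻¹' Metric.ball (1 / 2) δ) := by
    rw [Set.disjoint_left]
    intro x hx hx'
    rw [mem_preimage, Metric.mem_ball, Real.dist_eq, abs_lt] at hx'
    rw [Metric.mem_ball, Real.dist_eq] at hx
    have h1 : s * (foldZero s e - |x - 1 / 2|) ≤ symmetricW s e x := le_max_left _ _
    rw [mul_sub, mul_foldZero hs] at h1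
    nlinarith [hx'.2]
  have hm : MeasurableSet (symmetricW s e ⁻¹' Metric.ball (1 / 2) δ) :=
    h.measurable Metric.isOpen_ball.measurableSet
  have h1 := prob_le_one (μ := μ)
    (s := Metric.ball (1 / 2) δ ∪ symmetricW s e ⁻¹' Metric.ball (1 / 2) δ)
  rw [measure_union hdisj hm, h.measure_preimage Metric.isOpen_ball.measurableSet.nullMeasurableSet]
    at h1
  have h2 := ENNReal.add_lt_add hμ hμ
  rw [ENNReal.add_halves] at h2
  exact absurd (h2.trans_le h1) (lt_irrefl _)

theorem tendsto_peak {s e : ℕ → ℝ} {μ : ℕ → ProbabilityMeasure ℝ}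
    (hs : ∀ᶠ n in atTop, 2 ≤ s n ∧ s n ≤ 3) (he : ∀ᶠ n in atTop, 0 ≤ e n)
    (h : ∀ᶠ n in atTop, MeasurePreserving (symmetricW (s n) (e n)) (μ n : Measure ℝ) (μ n))
    (hμ : Tendsto μ atTop (𝓝 diracHalf)) : Tendsto e atTop (𝓝 0) := by
  rw [Metric.tendsto_nhds]
  intro ε hε
  -- Radius `ε/8` suffices: `s ≤ 3` gives `e ≤ 4 · ε/8 < ε`.
  have hb := tendsto_measure_of_tendsto_diracHalf hμ (E := Metric.ball (1 / 2) (ε / 8)) (by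
    rw [frontier_ball _ (by positivity)]
    rw [Metric.mem_sphere, dist_self]
    exact (show 0 < ε / 8 by positivity).ne)
  rw [Measure.dirac_apply_of_mem (Metric.mem_ball_self (by positivity))] at hb
  filter_upwards [hs, he, h, hb.eventually (lt_mem_nhds ENNReal.one_half_lt_one)]
    with n ⟨h1, h1'⟩ h2 h3 h4
  have := peak_le_of_half_lt h1 h3 (by rwa [one_div])
  rw [Real.dist_0_eq_abs, abs_of_nonneg h2]
  nlinarith

theorem abs_symmetricW_sub_le {s e x : ℝ} (hs : 2 ≤ s) (he : 0 ≤ e) (he' : e < 1 / 2)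
    (hx : x ∈ Icc (0 : ℝ) 1) :
    |symmetricW s e x - symmetricW 2 0 x| ≤ e + (s - 2) + |outerSlope s e - 4| := by
  have hy := abs_sub_half_mem hx
  unfold symmetricW
  set y := |x - 1 / 2|
  have k1 := outerSlope_mul hs he he'
  have k2 := outerSlope_mul (s := 2) (e := 0) le_rfl le_rfl (by norm_num)
  have z1 := mul_foldZero (e := e) hs
  have z2 := mul_foldZero (s := 2) (e := 0) le_rfl
  have k4 : outerSlope 2 0 = 4 := by norm_num [outerSlope]
  have e1 : s * (foldZero s e - y) - 2 * (foldZero 2 0 - y) = e - (s - 2) * y := by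
    linear_combination z1 - z2
  have e2 : outerSlope s e * (y - foldZero s e) - outerSlope 2 0 * (y - foldZero 2 0)
      = -((outerSlope s e - 4) * (1 / 2 - y)) := by
    linear_combination k1 - k2 + (1 / 2 - y) * k4
  refine (abs_max_sub_max_le_max _ _ _ _).trans (max_le ?_ ?_)
  · rw [e1, abs_le]
    have := abs_nonneg (outerSlope s e - 4)
    constructor <;> nlinarith [hy.1, hy.2]
  · rw [e2, abs_neg, abs_mul]
    have : |1 / 2 - y| ≤ 1 := abs_le.2 ⟨by linarith [hy.2], by linarith [hy.1]⟩
    have := mul_le_of_le_one_right (abs_nonneg (outerSlope s e - 4)) this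
    linarith

theorem tendstoUniformlyOn_symmetricW {s e : ℕ → ℝ} (hs : ∀ᶠ n in atTop, 2 ≤ s n)
    (he : ∀ᶠ n in atTop, 0 ≤ e n ∧ e n < 1 / 2) (hs2 : Tendsto s atTop (𝓝 2))
    (he0 : Tendsto e atTop (𝓝 0)) :
    TendstoUniformlyOn (fun n => symmetricW (s n) (e n)) (symmetricW 2 0) atTop (Icc 0 1) := by
  have hk : Tendsto (fun n => outerSlope (s n) (e n)) atTop (𝓝 4) := by
    have := (hs2.const_mul 2).div ((hs2.sub_const 1).sub (he0.const_mul 2)) (by norm_num)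
    norm_num at this
    exact this
  have hb : Tendsto (fun n => e n + (s n - 2) + |outerSlope (s n) (e n) - 4|) atTop (𝓝 0) := by
    simpa using (he0.add (hs2.sub_const 2)).add (hk.sub_const 4).abs
  rw [Metric.tendstoUniformlyOn_iff]
  intro ε hε
  filter_upwards [hs, he, hb.eventually (gt_mem_nhds hε)] with n h1 h2 h3 x hx
  rw [dist_comm, Real.dist_eq]
  exact (abs_symmetricW_sub_le h1 h2.1 h2.2 hx).trans_lt h3

/-- The density is positive `μ`-almost everywhere, hence Lebesgue-almost everywhere on `[0, 1]` by
the second absolute continuity; so the lower bound holds on all of `E`. -/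
theorem ofReal_mul_volume_le_of_density {μ : ProbabilityMeasure ℝ} {c : ℝ}
    (h₁ : (μ : Measure ℝ) ≪ volume) (h₂ : volume.restrict (Icc (0 : ℝ) 1) ≪ (μ : Measure ℝ))
    (hc : ∀ᵐ x ∂volume, density μ x ≠ 0 → ENNReal.ofReal c ≤ density μ x) {E : Set ℝ}
    (hE : E ⊆ Icc 0 1) : ENNReal.ofReal c * volume E ≤ (μ : Measure ℝ) E := by
  have hz : ∀ᵐ x ∂(μ : Measure ℝ), density μ x ≠ 0 := by
    filter_upwards [Measure.rnDeriv_pos h₁] with x hx using hx.ne'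
  have hz' : ∀ᵐ x ∂volume.restrict E, density μ x ≠ 0 :=
    ae_restrict_of_ae_restrict_of_subset hE (h₂.ae_le hz)
  rw [← Measure.setLIntegral_rnDeriv h₁, ← setLIntegral_const]
  refine lintegral_mono_ae ?_
  filter_upwards [hz', ae_restrict_of_ae hc] with x hx hx' using hx' hx

theorem not_exists_density_bound {μ : ℕ → ProbabilityMeasure ℝ}
    (h₁ : ∀ n, 1 ≤ n → (μ n : Measure ℝ) ≪ volume)
    (h₂ : ∀ n, 1 ≤ n → volume.restrict (Icc (0 : ℝ) 1) ≪ (μ n : Measure ℝ))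
    (hμ : Tendsto μ atTop (𝓝 diracHalf)) :
    ¬ ∃ c : ℝ, 0 < c ∧ ∀ n : ℕ, 1 ≤ n →
      ∀ᵐ x ∂volume, density (μ n) x ≠ 0 → ENNReal.ofReal c ≤ density (μ n) x := by
  rintro ⟨c, hc, h⟩
  -- Any interval away from `1/2` would do: its mass tends to `0`, while the bound keeps it above
  -- `c/4`.
  have ht := tendsto_measure_of_tendsto_diracHalf hμ (E := Icc 0 (1 / 4)) (by
    rw [frontier_Icc (by norm_num)]; norm_num)
  rw [Measure.dirac_apply' _ measurableSet_Icc, indicator_of_notMem (by norm_num)] at ht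
  have hle := ge_of_tendsto ht (b := ENNReal.ofReal c * volume (Icc (0 : ℝ) (1 / 4))) (by
    filter_upwards [eventually_ge_atTop 1] with n hn
    exact ofReal_mul_volume_le_of_density (h₁ n hn) (h₂ n hn) (h n hn)
      (Icc_subset_Icc le_rfl (by norm_num)))
  rw [Real.volume_Icc, ← ENNReal.ofReal_mul hc.le, nonpos_iff_eq_zero, ENNReal.ofReal_eq_zero]
    at hle
  linarith

theorem eventually_dist_lt {r : ℝ} (hr : 0 < r) {μ : ℝ → ProbabilityMeasure ℝ}
    {μ₀ : ProbabilityMeasure ℝ}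
    (hμ : ∀ a : ℝ, 0 < a → r * a < 1 / 2 → IsAcim (wFamily r a) (μ a)) (hμ₀ : IsAcim wZero μ₀)
    {d : ProbabilityMeasure ℝ → ProbabilityMeasure ℝ → ℝ} (hd : IsWeakMetric d) {η : ℝ}
    (hη : 0 < η) :
    ∃ ε : ℝ, 0 < ε ∧ ∀ a : ℝ, 0 < a → a < ε →
      r * a < 1 / 2 ∧ d (μ a) (limitMeasure μ₀ r hr.le) < η := by
  have h1 := (tendsto_acim hr hμ hμ₀).eventually ((hd.nhds_basis _).mem_of_mem hη)
  have h2 := h1.and (eventually_small hr)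
  obtain ⟨ε, hε, h⟩ := mem_nhdsGT_iff_exists_Ioo_subset.1 h2
  refine ⟨ε, hε, fun a ha haε => ?_⟩
  obtain ⟨h3, h4⟩ := h ⟨ha, haε⟩
  exact ⟨by linarith [h4.2.2], h3⟩

theorem mainTheorem4 :
    -- every `W_{a,r}` maps `[0,1]` onto itself and has exactly one acim
    (∀ r a : ℝ, 0 < r → 0 ≤ a → r * a < 1 / 2 →
      wFamily r a '' Icc 0 1 = Icc 0 1 ∧
      ∃! μ : ProbabilityMeasure ℝ, IsAcim (wFamily r a) μ) ∧
    -- for `a > 0` all slopes exceed `2` in modulus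
    (∀ r a : ℝ, 0 < r → 0 < a → r * a < 1 / 2 →
      ∀ x ∈ Icc (0 : ℝ) 1 \ wBreaks r a, 2 < |derivWithin (wFamily r a) (Icc 0 1) x|) ∧
    -- in what follows `μ a r` is the acim of `W_{a,r}` and `μ₀` is the acim of `W_0`
    ∀ (μ : ℝ → ℝ → ProbabilityMeasure ℝ) (μ₀ : ProbabilityMeasure ℝ),
      (∀ r a : ℝ, 0 < r → 0 < a → r * a < 1 / 2 → IsAcim (wFamily r a) (μ a r)) →
      IsAcim wZero μ₀ →
      -- the acim has full support and is exact
      (∀ r a : ℝ, 0 < r → 0 < a → r * a < 1 / 2 →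
        (μ a r : Measure ℝ).support = Icc 0 1 ∧
        volume.restrict (Icc 0 1) ≪ (μ a r : Measure ℝ) ∧
        IsExact (wFamily r a) (μ a r)) ∧
      -- the weak limit for fixed `r`
      (∀ (r : ℝ) (hr : 0 < r),
        Tendsto (fun a => μ a r) (𝓝[>] 0) (𝓝 (limitMeasure μ₀ r hr.le))) ∧
      ∀ d : ProbabilityMeasure ℝ → ProbabilityMeasure ℝ → ℝ, IsWeakMetric d →
        -- all sufficiently small `a_n` satisfy the two conditions imposed below
        (∀ n : ℕ, 1 ≤ n → ∃ ε : ℝ, 0 < ε ∧ ∀ a : ℝ, 0 < a → a < ε →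
          n * a < 1 / 2 ∧ d (μ a n) (limitMeasure μ₀ n n.cast_nonneg) < 1 / n) ∧
        -- `τ_n = W_{a_n,n}` tends to `W_0`, the acims tend to `δ_{1/2}`, and the densities
        -- have no common positive lower bound on their supports
        ∀ a : ℕ → ℝ,
          (∀ n : ℕ, 1 ≤ n → 0 < a n ∧ n * a n < 1 / 2 ∧
            d (μ (a n) n) (limitMeasure μ₀ n n.cast_nonneg) < 1 / n) →
          TendstoUniformlyOn (fun n : ℕ => wFamily n (a n)) wZero atTop (Icc 0 1) ∧
          Tendsto (fun n : ℕ => μ (a n) n) atTop (𝓝 diracHalf) ∧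
          ¬ ∃ c : ℝ, 0 < c ∧ ∀ n : ℕ, 1 ≤ n →
            ∀ᵐ x ∂volume, density (μ (a n) n) x ≠ 0 →
              ENNReal.ofReal c ≤ density (μ (a n) n) x := by
  have wf : ∀ r a : ℝ, 0 < r → 0 ≤ a → r * a < 1 / 2 →
      0 ≤ r * a ∧ wFamily r a = symmetricW (2 + a) (r * a) := fun r a hr ha hra =>
    ⟨by positivity, wFamily_eq_symmetricW ha (by positivity) hra⟩
  refine ⟨fun r a hr ha hra => ?_, fun r a hr ha hra x hx =>
    two_lt_abs_derivWithin_wFamily ha (by positivity) hra hx, fun μ μ₀ hμ hμ₀ => ?_⟩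
  · obtain ⟨he, hw⟩ := wf r a hr ha hra
    have h : r * a = 0 ∨ 2 < 2 + a := by
      rcases ha.eq_or_lt with rfl | h
      · exact Or.inl (mul_zero r)
      · exact Or.inr (by linarith)
    rw [hw]
    refine ⟨image_symmetricW (by linarith) he hra, ?_⟩
    obtain ⟨μ, hμ⟩ := exists_isAcim_symmetricW (by linarith) he hra h
    exact ⟨μ, hμ, fun ν hν => hν.unique (by linarith) he hra h hμ⟩
  have hac : ∀ r a : ℝ, 0 < r → 0 < a → r * a < 1 / 2 →
      volume.restrict (Icc 0 1) ≪ (μ a r : Measure ℝ) := fun r a hr ha hra => by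
    obtain ⟨he, hw⟩ := wf r a hr ha.le hra
    have h := hμ r a hr ha hra
    rw [hw] at h
    exact h.absolutelyContinuous (by linarith) he hra
  refine ⟨fun r a hr ha hra => ⟨(hμ r a hr ha hra).support_eq (hac r a hr ha hra),
    hac r a hr ha hra, ?_⟩, fun r hr => tendsto_acim hr (fun a => hμ r a hr) hμ₀, fun d hd =>
    ⟨fun n hn => ?_, fun a ha => ?_⟩⟩
  · obtain ⟨he, hw⟩ := wf r a hr ha.le hra
    have h := hμ r a hr ha hra
    rw [hw] at h ⊢
    exact h.isExact (by linarith) he hra (Or.inr (by linarith))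
  · have hn' : (0 : ℝ) < n := by exact_mod_cast hn
    exact eventually_dist_lt hn' (fun a => hμ n a hn') hμ₀ hd (by positivity)
  · have hpos : ∀ n : ℕ, 1 ≤ n → (0 : ℝ) < n := fun n hn => by exact_mod_cast hn
    have hlim : Tendsto (fun n : ℕ => μ (a n) n) atTop (𝓝 diracHalf) :=
      hd.tendsto_of_lt (tendsto_limitMeasure μ₀) fun n hn => (ha n hn).2.2
    have hacim : ∀ n : ℕ, 1 ≤ n → IsAcim (wFamily n (a n)) (μ (a n) n) := fun n hn =>
      hμ n (a n) (hpos n hn) (ha n hn).1 (ha n hn).2.1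
    have ha0 : Tendsto a atTop (𝓝 0) := by
      refine tendsto_of_tendsto_of_tendsto_of_le_of_le' tendsto_const_nhds
        tendsto_one_div_atTop_nhds_zero_nat ?_ ?_
      · filter_upwards [eventually_ge_atTop 1] with n hn using (ha n hn).1.le
      · filter_upwards [eventually_ge_atTop 1] with n hn
        rw [le_div_iff₀ (hpos n hn)]
        linarith [(ha n hn).2.1]
    have hW : ∀ᶠ n : ℕ in atTop, 0 < a n ∧ (0 ≤ n * a n ∧ n * a n < 1 / 2) ∧
        wFamily n (a n) = symmetricW (2 + a n) (n * a n) := by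
      filter_upwards [eventually_ge_atTop 1] with n hn
      obtain ⟨he, hw⟩ := wf n (a n) (hpos n hn) (ha n hn).1.le (ha n hn).2.1
      exact ⟨(ha n hn).1, ⟨he, (ha n hn).2.1⟩, hw⟩
    -- The condition `n a_n < 1/2` gives only `a_n → 0`; that the peaks tend to `1/2` is extracted
    -- from the weak limit.
    have hpeak : Tendsto (fun n : ℕ => n * a n) atTop (𝓝 0) := by
      refine tendsto_peak (s := fun n => 2 + a n) ?_ (hW.mono fun n h => h.2.1.1) ?_ hlim
      · filter_upwards [hW, ha0.eventually (ge_mem_nhds one_pos)] with n h h'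
        exact ⟨by linarith [h.1], by linarith⟩
      · filter_upwards [hW, eventually_ge_atTop 1] with n h hn
        rw [← h.2.2]
        exact (hacim n hn).1
    refine ⟨?_, hlim, not_exists_density_bound (fun n hn => (hacim n hn).2.trans
      Measure.restrict_le_self.absolutelyContinuous)
      (fun n hn => hac n (a n) (hpos n hn) (ha n hn).1 (ha n hn).2.1) hlim⟩
    rw [wZero_eq_symmetricW]
    refine (tendstoUniformlyOn_symmetricW (s := fun n => 2 + a n) (e := fun n => n * a n)
      (hW.mono fun n h => by linarith [h.1]) (hW.mono fun n h => h.2.1)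
      (by simpa using ha0.const_add 2) hpeak).congr ?_
    filter_upwards [hW] with n h x _
    rw [h.2.2]
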